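/- Let $M$ be a smooth Riemannian 3-manifold with Levi-Civita connection $\nabla$, let $U\subseteq M$ be open, and let $(\mathbf n_1,\mathbf n_2,\mathbf n_3)$ be a smooth orthonormal frame on $U$; the unit field $\mathbf n=\mathbf n_1$ is the director. Let $\eta^i$ be the dual frame, $\eta_i^j(v)=\langle\nabla_v\mathbf n_i,\mathbf n_j\rangle$ the connection forms, $f_{,i}=\mathbf n_i\cdot\nabla f$, and $R_{ijkl}=\langle R(\mathbf n_k,\mathbf n_l)\mathbf n_j,\mathbf n_i\rangle$ with $R(X,Y)=\nabla_X\nabla_Y-\nabla_Y\nabla_X-\nabla_{[X,Y]}$ (so that $R_{1212}$ is a sectional curvature). Let $s=\nabla\cdot\mathbf n$ be the splay, $t=\langle\nabla_{\mathbf n_2}\mathbf n,\mathbf n_3\rangle-\langle\nabla_{\mathbf n_3}\mathbf n,\mathbf n_2\rangle$ the twist (that is, $\mathbf n\cdot\nabla\times\mathbf n$ in the orientation for which the frame is positive), $\mathbf b=-\nabla_{\mathbf n}\mathbf n=b_\perp\mathbf n_2+b_\times\mathbf n_3$ the bend vector, and $\Delta_1,\Delta_2$ the $(\mathbf n_2,\mathbf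 n_2)$ and $(\mathbf n_2,\mathbf n_3)$ entries of the biaxial splay, i.e. of the symmetric traceless part of $\nabla\mathbf n$ on the plane orthogonal to $\mathbf n$. Put $b^2=b_\perp^2+b_\times^2$, $\Delta^2=\Delta_1^2+\Delta_2^2$, $\kappa_2^1=\langle\nabla_{\mathbf n_2}\mathbf n_2,\mathbf n_3\rangle$, $\kappa_3^2=\langle\nabla_{\mathbf n_3}\mathbf n_3,\mathbf n_2\rangle$, $\omega_1=\langle\nabla_{\mathbf n_1}\mathbf n_2,\mathbf n_3\rangle$. Then the following hold on $U$. 1. (Connection forms) $$\eta_1^2=-b_\perp\eta^1+(\tfrac s2+\Delta_1)\eta^2+(-\tfrac t2+\Delta_2)\eta^3,\quad \eta_1^3=-b_\times\eta^1+(\tfrac t2+\Delta_2)\eta^2+(\tfrac s2-\Delta_1)\eta^3,\quad \eta_2^3=\omega_1\eta^1+\kappa_2^1\eta^2-\kappa_3^2\eta^3 .$$ 2. (Structure equations and symmetries) $d\eta^i=\sum_p\eta^p\wedge\eta_p^i$ and $d\eta_i^j-\sum_p\eta_i^p\wedge\eta_p^j=-\sum_{k<l}R_{ijkl}\,\eta^k\wedge\eta^l$;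 moreover $R_{ijkl}=-R_{jikl}=-R_{ijlk}=R_{klij}$. 3. (Nine relations) $$\begin{aligned} R_{1212}&=-(\tfrac s2+\Delta_1)_{,1}-b_{\perp,2}-b_\perp^2-\tfrac{s^2}4+\tfrac{t^2}4-s\Delta_1-\Delta^2+2\omega_1\Delta_2+\kappa_2^1b_\times,\\ R_{1213}&=-(-\tfrac t2+\Delta_2)_{,1}-b_{\perp,3}-b_\perp b_\times-s(-\tfrac t2+\Delta_2)-2\omega_1\Delta_1-\kappa_3^2b_\times,\\ R_{1223}&=-(-\tfrac t2+\Delta_2)_{,2}+(\tfrac s2+\Delta_1)_{,3}+tb_\perp-2\kappa_2^1\Delta_1+2\kappa_3^2\Delta_2,\\ R_{1312}&=-(\tfrac t2+\Delta_2)_{,1}-b_{\times,2}-b_\perp b_\times-s(\tfrac t2+\Delta_2)-2\omega_1\Delta_1-\kappa_2^1b_\perp,\\ R_{1313}&=-(\tfrac s2-\Delta_1)_{,1}-b_{\times,3}-b_\times^2-\tfrac{s^2}4+\tfrac{t^2}4+s\Delta_1-\Delta^2-2\omega_1\Delta_2+\kappa_3^2b_\perp,\\ R_{1323}&=-(\tfrac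 s2-\Delta_1)_{,2}+(\tfrac t2+\Delta_2)_{,3}+tb_\times-2\kappa_2^1\Delta_2-2\kappa_3^2\Delta_1,\\ R_{2312}&=-\kappa^1_{2,1}+\omega_{1,2}-(b_\times+\kappa_2^1)(\tfrac s2+\Delta_1)+(b_\perp+\kappa_3^2)(\tfrac t2+\Delta_2)+b_\perp\omega_1-\kappa_3^2\omega_1,\\ R_{2313}&=\kappa^2_{3,1}+\omega_{1,3}+(b_\perp+\kappa_3^2)(\tfrac s2-\Delta_1)-(b_\times+\kappa_2^1)(-\tfrac t2+\Delta_2)+b_\times\omega_1-\kappa_2^1\omega_1,\\ R_{2323}&=\kappa^2_{3,2}+\kappa^1_{2,3}-(\kappa_2^1)^2-(\kappa_3^2)^2-t\omega_1-\tfrac{s^2}4-\tfrac{t^2}4+\Delta^2 . \end{aligned}$$ 4. (Gauge freedom) Near any point, a smooth rotation of $(\mathbf n_2,\mathbf n_3)$ about $\mathbf n$ achieves $\Delta_2=0$ if $\Delta\ne0$ at the point, or $b_\times=0$ if $\mathbf b\neq0$ at the point (so five local fields remain); likewise, near any point, $\omega_1=0$ can be achieved. 5. ($\Delta\neq0$ on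 $U$) The auxiliary fields are $$\begin{aligned} \kappa_2^1={}&-\tfrac{\Delta_1R_{1223}+\Delta_2R_{1323}}{2\Delta^2}+\tfrac{\Delta_1t_{,2}-\Delta_2s_{,2}+\Delta_1s_{,3}+\Delta_2t_{,3}}{4\Delta^2}-\tfrac{\Delta_1\Delta_{2,2}-\Delta_2\Delta_{1,2}}{2\Delta^2}+\tfrac{(\Delta^2)_{,3}}{4\Delta^2}+t\,\tfrac{b_\perp\Delta_1+b_\times\Delta_2}{2\Delta^2},\\ \kappa_3^2={}&-\tfrac{\Delta_1R_{1323}-\Delta_2R_{1223}}{2\Delta^2}-\tfrac{\Delta_2t_{,2}+\Delta_1s_{,2}-\Delta_1t_{,3}+\Delta_2s_{,3}}{4\Delta^2}+\tfrac{\Delta_1\Delta_{2,3}-\Delta_2\Delta_{1,3}}{2\Delta^2}+\tfrac{(\Delta^2)_{,2}}{4\Delta^2}-t\,\tfrac{b_\perp\Delta_2-b_\times\Delta_1}{2\Delta^2},\\ \omega_1={}&\tfrac{\Delta_2R_{1212}-\Delta_2R_{1313}-\Delta_1R_{1213}-\Delta_1R_{1312}}{4\Delta^2}+\tfrac{b_\perp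 R_{1223}+b_\times R_{1323}}{8\Delta^2}+\tfrac{\Delta_2\Delta_{1,1}-\Delta_1\Delta_{2,1}}{2\Delta^2}\\ &-\tfrac{\Delta_1b_{\times,2}+\Delta_1b_{\perp,3}-\Delta_2b_{\perp,2}+\Delta_2b_{\times,3}}{4\Delta^2}-\tfrac{tb^2}{8\Delta^2}-\tfrac{b_\times\Delta_{1,2}-b_\perp\Delta_{2,2}+b_\perp\Delta_{1,3}+b_\times\Delta_{2,3}}{8\Delta^2}\\ &-\tfrac{b_\perp(t_{,2}+s_{,3})+b_\times(t_{,3}-s_{,2})}{16\Delta^2}+\tfrac{(b_\perp^2-b_\times^2)\Delta_2-2b_\perp b_\times\Delta_1}{4\Delta^2}. \end{aligned}$$ With these expressions substituted for $\kappa_2^1,\kappa_3^2,\omega_1$, the modes satisfy six relations: three of first order, $$\begin{aligned} R_{1212}+R_{1313}&=-s_{,1}-b_{\perp,2}-b_{\times,3}-b^2-\tfrac{s^2}2+\tfrac{t^2}2-2\Delta^2+\kappa_2^1b_\times+\kappa_3^2b_\perp,\\ 0&=-t_{,1}-b_{\times,2}+b_{\perp,3}-st-\kappa_2^1b_\perp+\kappa_3^2b_\times,\\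 s&=\tfrac{\Delta_1(R_{1313}-R_{1212})-\Delta_2(R_{1213}+R_{1312})}{2\Delta^2}-\tfrac{(b_\perp^2-b_\times^2)\Delta_1+2b_\perp b_\times\Delta_2}{2\Delta^2}-\tfrac{\Delta_1(b_{\perp,2}-b_{\times,3})+\Delta_2(b_{\times,2}+b_{\perp,3})}{2\Delta^2}\\ &\quad-\tfrac{(\Delta^2)_{,1}}{2\Delta^2}-\kappa_2^1\tfrac{b_\perp\Delta_2-b_\times\Delta_1}{2\Delta^2}-\kappa_3^2\tfrac{b_\perp\Delta_1+b_\times\Delta_2}{2\Delta^2}, \end{aligned}$$ and three of second order, namely those for $R_{2312},R_{2313},R_{2323}$ in 3. For arbitrary smooth fields $s,t,b_\perp,b_\times,\Delta_1,\Delta_2$ on $U$ with $\Delta\ne0$, arbitrary functions $\kappa_2^1,\kappa_3^2,\omega_1$ and arbitrary functions $R_{ijkl}$ with $R_{1213}=R_{1312}$, the nine relations of 3 hold on $U$ if and only if the three expressions and the six relations hold on $U$. 6. ($\Delta=0$ and $\mathbf b\ne0$ on $U$) Then $$\begin{aligned} \kappa_2^1&=\tfrac{b_\times R_{1212}-b_\perp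 R_{1312}}{b^2}+\tfrac{b_\times s_{,1}-b_\perp t_{,1}}{2b^2}-\tfrac{b_\perp b_{\times,2}-b_\times b_{\perp,2}}{b^2}-\tfrac{(t^2-s^2)b_\times+2stb_\perp}{4b^2},\\ \kappa_3^2&=\tfrac{b_\perp R_{1313}-b_\times R_{1213}}{b^2}+\tfrac{b_\times t_{,1}+b_\perp s_{,1}}{2b^2}+\tfrac{b_\perp b_{\times,3}-b_\times b_{\perp,3}}{b^2}+\tfrac{(s^2-t^2)b_\perp+2stb_\times}{4b^2}. \end{aligned}$$ The modes satisfy four relations of first order: $$\begin{aligned} b_\perp R_{1212}+b_\times R_{1312}&=-\tfrac{b_\perp s_{,1}+b_\times t_{,1}}2-b_\perp b_{\perp,2}-b_\times b_{\times,2}-b_\perp b^2+\tfrac{(t^2-s^2)b_\perp-2stb_\times}4,\\ b_\perp R_{1213}+b_\times R_{1313}&=\tfrac{b_\perp t_{,1}-b_\times s_{,1}}2-b_\perp b_{\perp,3}-b_\times b_{\times,3}-b_\times b^2+\tfrac{(t^2-s^2)b_\times+2stb_\perp}4,\\ R_{1223}&=\tfrac{t_{,2}+s_{,3}}2+tb_\perp,\qquad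 R_{1323}=\tfrac{t_{,3}-s_{,2}}2+tb_\times . \end{aligned}$$ The relations for $R_{2312},R_{2313},R_{2323}$ in 3 hold with these $\kappa_2^1,\kappa_3^2$ substituted and $\Delta_1=\Delta_2=0$. If moreover $t\ne0$ on $U$, then also $$\omega_1=\tfrac1t\left(\kappa^2_{3,2}+\kappa^1_{2,3}-(\kappa_2^1)^2-(\kappa_3^2)^2-\tfrac{s^2}4-\tfrac{t^2}4-R_{2323}\right),$$ and six relations remain: the four above and those for $R_{2312}$ and $R_{2313}$ with this $\omega_1$ substituted. (Without $t\neq0$, one may instead use a frame with $\omega_1=0$, by 4.) Again, for arbitrary smooth modes with $\Delta=0$, $b\ne0$ on $U$ and arbitrary functions $\kappa_2^1,\kappa_3^2,\omega_1,R_{ijkl}$, the nine relations hold on $U$ if and only if the two expressions for $\kappa_2^1,\kappa_3^2$, the four first-order relations and the three substituted relations for $R_{23kl}$ hold on $U$; and, if $t\neq0$ on $U$, if and only if the three expressions for the auxiliary fields and the six remaining relations hold on $U$. 7. ($\Delta=0$ and $\mathbf b=0$ on $U$) Then $R_{1212}=R_{1313}$ and $R_{1213}=R_{1312}=0$. -/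

import Mathlib

open Bundle
open scoped Manifold ContDiff

noncomputable section

namespace DirectorField

/-! ### Riemannian 3-manifolds: frames, Levi-Civita connection, curvature -/

section Geometry

variable {M : Type*} [TopologicalSpace M] [ChartedSpace (EuclideanSpace ℝ (Fin 3)) M]

/-- A (not necessarily smooth) vector field on the 3-manifold `M`. -/
abbrev VField (M : Type*) [TopologicalSpace M] [ChartedSpace (EuclideanSpace ℝ (Fin 3)) M] :
    Type _ :=
  (x : M) → TangentSpace (𝓡 3) x

/-- A (not necessarily smooth) differential 1-form on `M`. -/
abbrev OneForm (M : Type*) [TopologicalSpace M] [ChartedSpace (EuclideanSpace ℝ (Fin 3)) M] :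
    Type _ :=
  (x : M) → TangentSpace (𝓡 3) x →L[ℝ] ℝ

/-- The derivative `f_{,i} = n_i · ∇ f` of a function along the `i`-th vector of the frame.
The frame `(n₁, n₂, n₃)` is indexed by `0, 1, 2 : Fin 3`; the director is `e 0`. -/
def D (e : Fin 3 → VField M) (i : Fin 3) (f : M → ℝ) (x : M) : ℝ :=
  mvfderiv (𝓡 3) f x (e i x)

/-- The exterior derivative of a 1-form, evaluated on two vector fields:
`dα(X, Y) = X(α(Y)) - Y(α(X)) - α([X, Y])`. -/
def extD (α : OneForm M) (X Y : VField M) (x : M) : ℝ :=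
  mvfderiv (𝓡 3) (fun y => α y (Y y)) x (X x) - mvfderiv (𝓡 3) (fun y => α y (X y)) x (Y x)
    - α x (VectorField.mlieBracket (𝓡 3) X Y x)

/-- The exterior product `(α ∧ β)(X, Y) = α(X) β(Y) - α(Y) β(X)` of two 1-forms. -/
def wedge (α β : OneForm M) (X Y : VField M) (x : M) : ℝ :=
  α x (X x) * β x (Y x) - α x (Y x) * β x (X x)

/-- The frame obtained from `e` by rotating `n₂, n₃` through the angle `θ` about the director. -/
def rotFrame (e : Fin 3 → VField M) (θ : M → ℝ) : Fin 3 → VField M :=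
  ![e 0,
    fun x => Real.cos (θ x) • e 1 x + Real.sin (θ x) • e 2 x,
    fun x => -Real.sin (θ x) • e 1 x + Real.cos (θ x) • e 2 x]

variable [IsManifold (𝓡 3) ∞ M]

/-- The curvature operator `R(X, Y) Z = ∇_X ∇_Y Z - ∇_Y ∇_X Z - ∇_{[X, Y]} Z`
(in Mathlib `∇_X Y` at `x` is written `nabla Y x (X x)`). -/
def curvOp
    (nabla : CovariantDerivative (𝓡 3) (EuclideanSpace ℝ (Fin 3))
      (fun x : M => TangentSpace (𝓡 3) x))
    (X Y Z : VField M) : VField M := fun x =>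
  nabla (fun y => nabla Z y (Y y)) x (X x) - nabla (fun y => nabla Z y (X y)) x (Y x)
    - nabla Z x (VectorField.mlieBracket (𝓡 3) X Y x)

variable [RiemannianBundle (fun x : M => TangentSpace (𝓡 3) x)]

/-- `e = (n₁, n₂, n₃)` is a smooth orthonormal frame on `U`; its first vector is the director. -/
structure IsOrthonormalFrameOn (e : Fin 3 → VField M) (U : Set M) : Prop where
  contMDiffOn : ∀ i, ContMDiffOn (𝓡 3) ((𝓡 3).prod 𝓘(ℝ, EuclideanSpace ℝ (Fin 3))) ∞
    (fun x => Bundle.TotalSpace.mk' (EuclideanSpace ℝ (Fin 3)) x (e i x)) U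
  orthonormal : ∀ x ∈ U, Orthonormal ℝ (fun i => e i x)

set_option synthInstance.maxHeartbeats 400000 in
set_option maxHeartbeats 1000000 in
/-- `nabla` is the Levi-Civita connection: torsion-free and compatible with the metric. -/
structure IsLeviCivita
    [IsContMDiffRiemannianBundle (𝓡 3) ∞ (EuclideanSpace ℝ (Fin 3))
      (fun x : M => TangentSpace (𝓡 3) x)]
    (nabla : CovariantDerivative (𝓡 3) (EuclideanSpace ℝ (Fin 3))
      (fun x : M => TangentSpace (𝓡 3) x)) : Prop where
  torsion_eq_zero : nabla.torsion = 0
  metric : nabla.IsMetricCompatible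

/-- The dual 1-form `η^i = ⟨n_i, ·⟩` of the orthonormal frame. -/
def coframe (e : Fin 3 → VField M) (i : Fin 3) : OneForm M := fun x => innerSL ℝ (e i x)

variable
  (nabla : CovariantDerivative (𝓡 3) (EuclideanSpace ℝ (Fin 3))
    (fun x : M => TangentSpace (𝓡 3) x))

/-- The connection form `η_i^j(v) = ⟨∇_v n_i, n_j⟩`. -/
def connForm (e : Fin 3 → VField M) (i j : Fin 3) : OneForm M := fun x =>
  (innerSL ℝ (e j x)).comp (nabla (e i) x)

/-- The components `R_{ijkl} = ⟨R(n_k, n_l) n_j, n_i⟩` of the Riemann tensor in the frame; with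
this sign `R_{1212}` is the sectional curvature of the plane spanned by `n₁` and `n₂`. -/
def riem (e : Fin 3 → VField M) (i j k l : Fin 3) (x : M) : ℝ :=
  inner ℝ (curvOp nabla (e k) (e l) (e j) x) (e i x)

/-! ### The deformation modes of a director field -/

/-- The splay `s = ∇ · n`, the trace of `v ↦ ∇_v n`. -/
def splay (n : VField M) (x : M) : ℝ :=
  LinearMap.trace ℝ (TangentSpace (𝓡 3) x) (nabla n x).toLinearMap

/-- The bend vector `b = -∇_n n`. -/
def bendVec (n : VField M) : VField M := fun x => -nabla n x (n x)

/-- The twist `t = n · (∇ × n)`, in the orientation for which the frame is positive. -/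
def twist (e : Fin 3 → VField M) (x : M) : ℝ :=
  inner ℝ (nabla (e 0) x (e 1 x)) (e 2 x) - inner ℝ (nabla (e 0) x (e 2 x)) (e 1 x)

/-- The biaxial splay: the symmetric traceless part of the gradient of `n` in the plane normal
to `n`. For arguments `u, v` orthogonal to `n` it is
`(⟨∇_u n, v⟩ + ⟨∇_v n, u⟩) / 2 - (s / 2) ⟨u, v⟩`. -/
def biaxialSplay (n : VField M) (x : M) (u v : TangentSpace (𝓡 3) x) : ℝ :=
  (inner ℝ (nabla n x u) v + inner ℝ (nabla n x v) u) / 2 - splay nabla n x / 2 * inner ℝ u v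

end Geometry

/-! ### Systems of relations among fields on `M`, derived along a frame `e` -/

/-- The fields `s, t, b_⊥, b_×, Δ₁, Δ₂`. -/
structure Modes (M : Type*) where
  s : M → ℝ
  t : M → ℝ
  bp : M → ℝ
  bx : M → ℝ
  d1 : M → ℝ
  d2 : M → ℝ

/-- The auxiliary fields `κ₂¹, κ₃², ω₁`. -/
structure Aux (M : Type*) where
  k21 : M → ℝ
  k32 : M → ℝ
  w1 : M → ℝ

namespace Modes

variable {M : Type*} (m : Modes M)

/-- `Δ² = Δ₁² + Δ₂²`. -/
def Dsq (x : M) : ℝ := m.d1 x ^ 2 + m.d2 x ^ 2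

/-- `b² = b_⊥² + b_×²`. -/
def bsq (x : M) : ℝ := m.bp x ^ 2 + m.bx x ^ 2

end Modes

section Actual

variable {M : Type*} [TopologicalSpace M] [ChartedSpace (EuclideanSpace ℝ (Fin 3)) M]
  [IsManifold (𝓡 3) ∞ M] [RiemannianBundle (fun x : M => TangentSpace (𝓡 3) x)]
  (nabla : CovariantDerivative (𝓡 3) (EuclideanSpace ℝ (Fin 3))
    (fun x : M => TangentSpace (𝓡 3) x))

/-- The deformation modes of the director `e 0`, with `b = b_⊥ n₂ + b_× n₃`, and with `Δ₁, Δ₂` the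
entries of the biaxial splay in the basis `n₂, n₃`. -/
def modes (e : Fin 3 → VField M) : Modes M where
  s := splay nabla (e 0)
  t := twist nabla e
  bp := fun x => inner ℝ (bendVec nabla (e 0) x) (e 1 x)
  bx := fun x => inner ℝ (bendVec nabla (e 0) x) (e 2 x)
  d1 := fun x => biaxialSplay nabla (e 0) x (e 1 x) (e 1 x)
  d2 := fun x => biaxialSplay nabla (e 0) x (e 1 x) (e 2 x)

/-- `κ₂¹ = ⟨∇_{n₂} n₂, n₃⟩`, `κ₃² = ⟨∇_{n₃} n₃, n₂⟩`, `ω₁ = ⟨∇_{n₁} n₂, n₃⟩`. -/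
def aux (e : Fin 3 → VField M) : Aux M where
  k21 := fun x => inner ℝ (nabla (e 1) x (e 1 x)) (e 2 x)
  k32 := fun x => inner ℝ (nabla (e 2) x (e 2 x)) (e 1 x)
  w1 := fun x => inner ℝ (nabla (e 1) x (e 0 x)) (e 2 x)

end Actual

section Relations

variable {M : Type*} [TopologicalSpace M] [ChartedSpace (EuclideanSpace ℝ (Fin 3)) M]

/-- The nine relations expressing the curvature components through the modes, the auxiliary fields
and their frame derivatives. Frame indices `1, 2, 3` are written `0, 1, 2`. -/
structure NineRelations (e : Fin 3 → VField M) (R : Fin 3 → Fin 3 → Fin 3 → Fin 3 → M → ℝ)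
    (m : Modes M) (a : Aux M) (x : M) : Prop where
  R1212 : R 0 1 0 1 x =
    -D e 0 (fun y => m.s y / 2 + m.d1 y) x - D e 1 m.bp x
      - m.bp x ^ 2 - m.s x ^ 2 / 4 + m.t x ^ 2 / 4 - m.s x * m.d1 x - m.Dsq x
      + 2 * a.w1 x * m.d2 x + a.k21 x * m.bx x
  R1213 : R 0 1 0 2 x =
    -D e 0 (fun y => -(m.t y / 2) + m.d2 y) x - D e 2 m.bp x
      - m.bp x * m.bx x - m.s x * (-(m.t x / 2) + m.d2 x)
      - 2 * a.w1 x * m.d1 x - a.k32 x * m.bx x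
  R1223 : R 0 1 1 2 x =
    -D e 1 (fun y => -(m.t y / 2) + m.d2 y) x + D e 2 (fun y => m.s y / 2 + m.d1 y) x
      + m.t x * m.bp x - 2 * a.k21 x * m.d1 x + 2 * a.k32 x * m.d2 x
  R1312 : R 0 2 0 1 x =
    -D e 0 (fun y => m.t y / 2 + m.d2 y) x - D e 1 m.bx x
      - m.bp x * m.bx x - m.s x * (m.t x / 2 + m.d2 x)
      - 2 * a.w1 x * m.d1 x - a.k21 x * m.bp x
  R1313 : R 0 2 0 2 x =
    -D e 0 (fun y => m.s y / 2 - m.d1 y) x - D e 2 m.bx x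
      - m.bx x ^ 2 - m.s x ^ 2 / 4 + m.t x ^ 2 / 4 + m.s x * m.d1 x - m.Dsq x
      - 2 * a.w1 x * m.d2 x + a.k32 x * m.bp x
  R1323 : R 0 2 1 2 x =
    -D e 1 (fun y => m.s y / 2 - m.d1 y) x + D e 2 (fun y => m.t y / 2 + m.d2 y) x
      + m.t x * m.bx x - 2 * a.k21 x * m.d2 x - 2 * a.k32 x * m.d1 x
  R2312 : R 1 2 0 1 x =
    -D e 0 a.k21 x + D e 1 a.w1 x - (m.bx x + a.k21 x) * (m.s x / 2 + m.d1 x)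
      + (m.bp x + a.k32 x) * (m.t x / 2 + m.d2 x) + m.bp x * a.w1 x - a.k32 x * a.w1 x
  R2313 : R 1 2 0 2 x =
    D e 0 a.k32 x + D e 2 a.w1 x + (m.bp x + a.k32 x) * (m.s x / 2 - m.d1 x)
      - (m.bx x + a.k21 x) * (-(m.t x / 2) + m.d2 x) + m.bx x * a.w1 x - a.k21 x * a.w1 x
  R2323 : R 1 2 1 2 x =
    D e 1 a.k32 x + D e 2 a.k21 x - a.k21 x ^ 2 - a.k32 x ^ 2 - m.t x * a.w1 x
      - m.s x ^ 2 / 4 - m.t x ^ 2 / 4 + m.Dsq x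

/-! #### Non-vanishing biaxial splay -/

variable (e : Fin 3 → VField M) (R : Fin 3 → Fin 3 → Fin 3 → Fin 3 → M → ℝ) (m : Modes M)

/-- The expression for `κ₂¹` when `Δ ≠ 0`. -/
def solvedK21 (x : M) : ℝ :=
  -(m.d1 x * R 0 1 1 2 x + m.d2 x * R 0 2 1 2 x) / (2 * m.Dsq x)
    + (m.d1 x * D e 1 m.t x - m.d2 x * D e 1 m.s x + m.d1 x * D e 2 m.s x + m.d2 x * D e 2 m.t x)
        / (4 * m.Dsq x)
    - (m.d1 x * D e 1 m.d2 x - m.d2 x * D e 1 m.d1 x) / (2 * m.Dsq x)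
    + D e 2 m.Dsq x / (4 * m.Dsq x)
    + m.t x * (m.bp x * m.d1 x + m.bx x * m.d2 x) / (2 * m.Dsq x)

/-- The expression for `κ₃²` when `Δ ≠ 0`. -/
def solvedK32 (x : M) : ℝ :=
  -(m.d1 x * R 0 2 1 2 x - m.d2 x * R 0 1 1 2 x) / (2 * m.Dsq x)
    - (m.d2 x * D e 1 m.t x + m.d1 x * D e 1 m.s x - m.d1 x * D e 2 m.t x + m.d2 x * D e 2 m.s x)
        / (4 * m.Dsq x)
    + (m.d1 x * D e 2 m.d2 x - m.d2 x * D e 2 m.d1 x) / (2 * m.Dsq x)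
    + D e 1 m.Dsq x / (4 * m.Dsq x)
    - m.t x * (m.bp x * m.d2 x - m.bx x * m.d1 x) / (2 * m.Dsq x)

/-- The expression for `ω₁` when `Δ ≠ 0`. -/
def solvedW1 (x : M) : ℝ :=
  (m.d2 x * R 0 1 0 1 x - m.d2 x * R 0 2 0 2 x - m.d1 x * R 0 1 0 2 x - m.d1 x * R 0 2 0 1 x)
        / (4 * m.Dsq x)
    + (m.bp x * R 0 1 1 2 x + m.bx x * R 0 2 1 2 x) / (8 * m.Dsq x)
    + (m.d2 x * D e 0 m.d1 x - m.d1 x * D e 0 m.d2 x) / (2 * m.Dsq x)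
    - (m.d1 x * D e 1 m.bx x + m.d1 x * D e 2 m.bp x - m.d2 x * D e 1 m.bp x
        + m.d2 x * D e 2 m.bx x) / (4 * m.Dsq x)
    - m.t x * m.bsq x / (8 * m.Dsq x)
    - (m.bx x * D e 1 m.d1 x - m.bp x * D e 1 m.d2 x + m.bp x * D e 2 m.d1 x
        + m.bx x * D e 2 m.d2 x) / (8 * m.Dsq x)
    - (m.bp x * (D e 1 m.t x + D e 2 m.s x) + m.bx x * (D e 2 m.t x - D e 1 m.s x))
        / (16 * m.Dsq x)
    + ((m.bp x ^ 2 - m.bx x ^ 2) * m.d2 x - 2 * m.bp x * m.bx x * m.d1 x) / (4 * m.Dsq x)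

/-- The auxiliary fields solved for in terms of the modes when `Δ ≠ 0`. -/
def solved : Aux M := ⟨solvedK21 e R m, solvedK32 e R m, solvedW1 e R m⟩

/-- The three compatibility relations of first order when `Δ ≠ 0`. Since `solved e R m` involves
the modes and their first derivatives only, so do these relations. -/
structure FirstOrderRelations (x : M) : Prop where
  sum : R 0 1 0 1 x + R 0 2 0 2 x =
    -D e 0 m.s x - D e 1 m.bp x - D e 2 m.bx x - m.bsq x - m.s x ^ 2 / 2 + m.t x ^ 2 / 2
      - 2 * m.Dsq x + solvedK21 e R m x * m.bx x + solvedK32 e R m x * m.bp x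
  diff : 0 =
    -D e 0 m.t x - D e 1 m.bx x + D e 2 m.bp x - m.s x * m.t x
      - solvedK21 e R m x * m.bp x + solvedK32 e R m x * m.bx x
  splay : m.s x =
    (m.d1 x * (R 0 2 0 2 x - R 0 1 0 1 x) - m.d2 x * (R 0 1 0 2 x + R 0 2 0 1 x)) / (2 * m.Dsq x)
      - ((m.bp x ^ 2 - m.bx x ^ 2) * m.d1 x + 2 * m.bp x * m.bx x * m.d2 x) / (2 * m.Dsq x)
      - (m.d1 x * (D e 1 m.bp x - D e 2 m.bx x) + m.d2 x * (D e 1 m.bx x + D e 2 m.bp x))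
          / (2 * m.Dsq x)
      - D e 0 m.Dsq x / (2 * m.Dsq x)
      - solvedK21 e R m x * (m.bp x * m.d2 x - m.bx x * m.d1 x) / (2 * m.Dsq x)
      - solvedK32 e R m x * (m.bp x * m.d1 x + m.bx x * m.d2 x) / (2 * m.Dsq x)

/-- The three compatibility relations of second order when `Δ ≠ 0`: the relations for
`R_{2312}, R_{2313}, R_{2323}` with the solved expressions, which involve first derivatives of the
modes, substituted for the auxiliary fields. -/
structure SecondOrderRelations (x : M) : Prop where
  R2312 : R 1 2 0 1 x =
    -D e 0 (solvedK21 e R m) x + D e 1 (solvedW1 e R m) x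
      - (m.bx x + solvedK21 e R m x) * (m.s x / 2 + m.d1 x)
      + (m.bp x + solvedK32 e R m x) * (m.t x / 2 + m.d2 x)
      + m.bp x * solvedW1 e R m x - solvedK32 e R m x * solvedW1 e R m x
  R2313 : R 1 2 0 2 x =
    D e 0 (solvedK32 e R m) x + D e 2 (solvedW1 e R m) x
      + (m.bp x + solvedK32 e R m x) * (m.s x / 2 - m.d1 x)
      - (m.bx x + solvedK21 e R m x) * (-(m.t x / 2) + m.d2 x)
      + m.bx x * solvedW1 e R m x - solvedK21 e R m x * solvedW1 e R m x
  R2323 : R 1 2 1 2 x =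
    D e 1 (solvedK32 e R m) x + D e 2 (solvedK21 e R m) x
      - solvedK21 e R m x ^ 2 - solvedK32 e R m x ^ 2 - m.t x * solvedW1 e R m x
      - m.s x ^ 2 / 4 - m.t x ^ 2 / 4 + m.Dsq x

/-! #### Vanishing biaxial splay, non-vanishing bend -/

/-- The expression for `κ₂¹` when `Δ = 0` and `b ≠ 0`. -/
def solvedK21₀ (x : M) : ℝ :=
  (m.bx x * R 0 1 0 1 x - m.bp x * R 0 2 0 1 x) / m.bsq x
    + (m.bx x * D e 0 m.s x - m.bp x * D e 0 m.t x) / (2 * m.bsq x)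
    - (m.bp x * D e 1 m.bx x - m.bx x * D e 1 m.bp x) / m.bsq x
    - ((m.t x ^ 2 - m.s x ^ 2) * m.bx x + 2 * m.s x * m.t x * m.bp x) / (4 * m.bsq x)

/-- The expression for `κ₃²` when `Δ = 0` and `b ≠ 0`. -/
def solvedK32₀ (x : M) : ℝ :=
  (m.bp x * R 0 2 0 2 x - m.bx x * R 0 1 0 2 x) / m.bsq x
    + (m.bx x * D e 0 m.t x + m.bp x * D e 0 m.s x) / (2 * m.bsq x)
    + (m.bp x * D e 2 m.bx x - m.bx x * D e 2 m.bp x) / m.bsq x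
    + ((m.s x ^ 2 - m.t x ^ 2) * m.bp x + 2 * m.s x * m.t x * m.bx x) / (4 * m.bsq x)

/-- The expression for `ω₁` when `Δ = 0`, `b ≠ 0` and `t ≠ 0`, from the relation for `R_{2323}`. -/
def solvedW1₀ (x : M) : ℝ :=
  (D e 1 (solvedK32₀ e R m) x + D e 2 (solvedK21₀ e R m) x
    - solvedK21₀ e R m x ^ 2 - solvedK32₀ e R m x ^ 2 - m.s x ^ 2 / 4 - m.t x ^ 2 / 4
    - R 1 2 1 2 x) / m.t x

/-- The four compatibility relations of first order when `Δ = 0` and `b ≠ 0`, none of which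
involves the auxiliary fields. -/
structure FirstOrderRelations₀ (x : M) : Prop where
  R12 : m.bp x * R 0 1 0 1 x + m.bx x * R 0 2 0 1 x =
    -(m.bp x * D e 0 m.s x + m.bx x * D e 0 m.t x) / 2
      - (m.bp x * D e 1 m.bp x + m.bx x * D e 1 m.bx x) - m.bp x * m.bsq x
      + ((m.t x ^ 2 - m.s x ^ 2) * m.bp x - 2 * m.s x * m.t x * m.bx x) / 4
  R13 : m.bp x * R 0 1 0 2 x + m.bx x * R 0 2 0 2 x =
    (m.bp x * D e 0 m.t x - m.bx x * D e 0 m.s x) / 2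
      - (m.bp x * D e 2 m.bp x + m.bx x * D e 2 m.bx x) - m.bx x * m.bsq x
      + ((m.t x ^ 2 - m.s x ^ 2) * m.bx x + 2 * m.s x * m.t x * m.bp x) / 4
  R1223 : R 0 1 1 2 x = (D e 1 m.t x + D e 2 m.s x) / 2 + m.t x * m.bp x
  R1323 : R 0 2 1 2 x = (D e 2 m.t x - D e 1 m.s x) / 2 + m.t x * m.bx x

/-- The relations for `R_{2312}, R_{2313}` when `Δ = 0` and `b ≠ 0`, with the solved expressions
substituted for `κ₂¹, κ₃²` and the function `w` for `ω₁`. -/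
structure LastTwoRelations₀ (w : M → ℝ) (x : M) : Prop where
  R2312 : R 1 2 0 1 x =
    -D e 0 (solvedK21₀ e R m) x + D e 1 w x - (m.bx x + solvedK21₀ e R m x) * (m.s x / 2)
      + (m.bp x + solvedK32₀ e R m x) * (m.t x / 2) + m.bp x * w x - solvedK32₀ e R m x * w x
  R2313 : R 1 2 0 2 x =
    D e 0 (solvedK32₀ e R m) x + D e 2 w x + (m.bp x + solvedK32₀ e R m x) * (m.s x / 2)
      - (m.bx x + solvedK21₀ e R m x) * (-(m.t x / 2)) + m.bx x * w x - solvedK21₀ e R m x * w x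

/-- The relation for `R_{2323}` when `Δ = 0` and `b ≠ 0`, with the solved expressions substituted
for `κ₂¹, κ₃²` and the function `w` for `ω₁`. -/
def RelationR2323₀ (w : M → ℝ) (x : M) : Prop :=
  R 1 2 1 2 x =
    D e 1 (solvedK32₀ e R m) x + D e 2 (solvedK21₀ e R m) x
      - solvedK21₀ e R m x ^ 2 - solvedK32₀ e R m x ^ 2 - m.t x * w x
      - m.s x ^ 2 / 4 - m.t x ^ 2 / 4

/-- All the fields in `m` are smooth on `U`. -/
structure Modes.SmoothOn (U : Set M) : Prop where
  s : ContMDiffOn (𝓡 3) 𝓘(ℝ, ℝ) ∞ m.s U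
  t : ContMDiffOn (𝓡 3) 𝓘(ℝ, ℝ) ∞ m.t U
  bp : ContMDiffOn (𝓡 3) 𝓘(ℝ, ℝ) ∞ m.bp U
  bx : ContMDiffOn (𝓡 3) 𝓘(ℝ, ℝ) ∞ m.bx U
  d1 : ContMDiffOn (𝓡 3) 𝓘(ℝ, ℝ) ∞ m.d1 U
  d2 : ContMDiffOn (𝓡 3) 𝓘(ℝ, ℝ) ∞ m.d2 U

end Relations

end DirectorField

end

/-! In an orthonormal frame the Levi-Civita connection is given by the nine functions ⟨∇_{n_k} n_i,
n_j⟩ with i < j (`gam`). Those with i = 1 are linear combinations of the six modes; those with (i,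
j) = (2, 3) are ω₁, κ₂¹ and -κ₃². Writing curvature as first derivatives plus quadratic terms in
these functions (`IsLeviCivita.riem_eq`) and substituting gives the nine relations. Smoothness of
the coefficients comes from the Koszul formula, and the curvature symmetries from skewness of the
connection forms together with the Jacobi identity.

The case distinction is linear algebra. The six relations for R_{1jkl} are affine in the values of
κ₂¹, κ₃², ω₁. If Δ ≠ 0, the pair R_{1223}, R_{1323} is a rotation-scaling system for (κ₂¹, κ₃²) with
determinant 4Δ². The pair R_{1212} - R_{1313}, R_{1213} + R_{1312} contains ω₁ with coefficient
vector 4(Δ₂, -Δ₁), so one projection solves for ω₁ and the orthogonal one is the relation for s.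
R_{1212} + R_{1313} and R_{1312} - R_{1213} do not contain ω₁ (`sixRelations_iff`). If Δ = 0, ω₁
drops out of all six, and the vector b plays the role of (Δ₁, Δ₂) (`sixRelations_iff₀`). The
relations for R_{23kl} contain derivatives of the auxiliary fields, so the solved expressions may be
substituted because they hold on an open set.

Under a rotation by θ the bend turns by θ, the biaxial splay by 2θ, and ω₁ gains n·∇θ. The first two
gauges thus need only a smooth local angle, the third a solution of n·∇θ = -ω₁. This is found by
characteristics from a flow smooth in time and initial value (`exists_local_flow`), which is
obtained by the inverse function theorem in a Banach space of curves. -/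

noncomputable section

namespace DirectorField


/-! ### Derivatives of functions along the frame. -/

section Derivation

variable {M : Type*} [TopologicalSpace M] [ChartedSpace (EuclideanSpace ℝ (Fin 3)) M]
  {e : Fin 3 → VField M} {i : Fin 3} {f g : M → ℝ} {x : M}

theorem D_congr (h : f =ᶠ[nhds x] g) : D e i f x = D e i g x := by
  simp only [D, mvfderiv, h.mfderiv_eq]; rfl

theorem D_congr_of_eqOn {U : Set M} (hU : IsOpen U) (hx : x ∈ U) (h : ∀ y ∈ U, f y = g y) :
    D e i f x = D e i g x :=
  D_congr (Filter.eventuallyEq_of_mem (hU.mem_nhds hx) h)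

theorem D_const (c : ℝ) : D e i (fun _ : M => c) x = 0 := by
  simp [D, mvfderiv_const]

theorem D_zero_of_eqOn {U : Set M} (hU : IsOpen U) (hx : x ∈ U) (h : ∀ y ∈ U, f y = 0) :
    D e i f x = 0 :=
  (D_congr_of_eqOn hU hx h).trans (D_const 0)

theorem D_add (hf : MDifferentiableAt (𝓡 3) 𝓘(ℝ, ℝ) f x)
    (hg : MDifferentiableAt (𝓡 3) 𝓘(ℝ, ℝ) g x) :
    D e i (fun y => f y + g y) x = D e i f x + D e i g x := by
  simp [D, mvfderiv_fun_add hf hg]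

theorem D_neg : D e i (fun y => -f y) x = -D e i f x := by
  simp [D, mvfderiv_fun_neg]

theorem D_sub (hf : MDifferentiableAt (𝓡 3) 𝓘(ℝ, ℝ) f x)
    (hg : MDifferentiableAt (𝓡 3) 𝓘(ℝ, ℝ) g x) :
    D e i (fun y => f y - g y) x = D e i f x - D e i g x := by
  simp [D, mvfderiv_fun_sub hf hg]

theorem D_mul (hf : MDifferentiableAt (𝓡 3) 𝓘(ℝ, ℝ) f x)
    (hg : MDifferentiableAt (𝓡 3) 𝓘(ℝ, ℝ) g x) :
    D e i (fun y => f y * g y) x = f x * D e i g x + g x * D e i f x := by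
  simp [D, mvfderiv_fun_mul hf hg]

theorem D_half (hf : MDifferentiableAt (𝓡 3) 𝓘(ℝ, ℝ) f x) :
    D e i (fun y => f y / 2) x = D e i f x / 2 := by
  have h := D_mul (e := e) (i := i) hf (mdifferentiableAt_const (c := (2⁻¹ : ℝ)))
  rw [D_const] at h
  simp only [div_eq_mul_inv]
  rw [h]; ring

theorem extD_of_eqOn {α : OneForm M} {k l : Fin 3} {U : Set M}
    (hU : IsOpen U) (hx : x ∈ U) (hf : ∀ y ∈ U, α y (e l y) = f y)
    (hg : ∀ y ∈ U, α y (e k y) = g y) :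
    extD α (e k) (e l) x = D e k f x - D e l g x
      - α x (VectorField.mlieBracket (𝓡 3) (e k) (e l) x) := by
  have h1 : D e k (fun y => α y (e l y)) x = D e k f x := D_congr_of_eqOn hU hx hf
  have h2 : D e l (fun y => α y (e k y)) x = D e l g x := D_congr_of_eqOn hU hx hg
  rw [← h1, ← h2]
  rfl

end Derivation

theorem Modes.d1_eq_zero {M : Type*} {m : Modes M} {x : M} (hD : m.Dsq x = 0) : m.d1 x = 0 := by
  have : m.d1 x ^ 2 + m.d2 x ^ 2 = 0 := hD
  nlinarith [sq_nonneg (m.d1 x), sq_nonneg (m.d2 x)]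

theorem Modes.d2_eq_zero {M : Type*} {m : Modes M} {x : M} (hD : m.Dsq x = 0) : m.d2 x = 0 := by
  have : m.d1 x ^ 2 + m.d2 x ^ 2 = 0 := hD
  nlinarith [sq_nonneg (m.d1 x), sq_nonneg (m.d2 x)]

/-! ### Linear algebra of the nine relations for arbitrary fields. -/

section FieldAlgebra

variable {M : Type*} [TopologicalSpace M] [ChartedSpace (EuclideanSpace ℝ (Fin 3)) M]
  {e : Fin 3 → VField M} {R : Fin 3 → Fin 3 → Fin 3 → Fin 3 → M → ℝ} {m : Modes M} {a : Aux M}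
  {x : M} {U : Set M}

/-- All the fields in `m` are differentiable at `x`. -/
structure Modes.MDiffAt (m : Modes M) (x : M) : Prop where
  s : MDifferentiableAt (𝓡 3) 𝓘(ℝ, ℝ) m.s x
  t : MDifferentiableAt (𝓡 3) 𝓘(ℝ, ℝ) m.t x
  bp : MDifferentiableAt (𝓡 3) 𝓘(ℝ, ℝ) m.bp x
  bx : MDifferentiableAt (𝓡 3) 𝓘(ℝ, ℝ) m.bx x
  d1 : MDifferentiableAt (𝓡 3) 𝓘(ℝ, ℝ) m.d1 x
  d2 : MDifferentiableAt (𝓡 3) 𝓘(ℝ, ℝ) m.d2 x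

theorem Modes.SmoothOn.mDiffAt (h : m.SmoothOn U) (hU : IsOpen U) (hx : x ∈ U) : m.MDiffAt x := by
  have key : ∀ {f : M → ℝ}, ContMDiffOn (𝓡 3) 𝓘(ℝ, ℝ) ∞ f U →
      MDifferentiableAt (𝓡 3) 𝓘(ℝ, ℝ) f x := fun hf =>
    (hf.contMDiffAt (hU.mem_nhds hx)).mdifferentiableAt (by simp)
  exact ⟨key h.s, key h.t, key h.bp, key h.bx, key h.d1, key h.d2⟩

theorem Modes.MDiffAt.D_Dsq (h : m.MDiffAt x) (i : Fin 3) :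
    D e i m.Dsq x = 2 * m.d1 x * D e i m.d1 x + 2 * m.d2 x * D e i m.d2 x := by
  have h1 := D_mul (e := e) (i := i) h.d1 h.d1
  have h2 := D_mul (e := e) (i := i) h.d2 h.d2
  have h3 := D_add (e := e) (i := i) (h.d1.mul h.d1) (h.d2.mul h.d2)
  have h4 : m.Dsq = fun y => m.d1 y * m.d1 y + m.d2 y * m.d2 y := by
    funext y; simp only [Modes.Dsq]; ring
  rw [h4]
  refine h3.trans ?_
  rw [show D e i (m.d1 * m.d1) x = _ from h1, show D e i (m.d2 * m.d2) x = _ from h2]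
  ring

theorem Modes.MDiffAt.D_half_s_add_d1 (h : m.MDiffAt x) (i : Fin 3) :
    D e i (fun y => m.s y / 2 + m.d1 y) x = D e i m.s x / 2 + D e i m.d1 x := by
  have h2 : MDifferentiableAt (𝓡 3) 𝓘(ℝ, ℝ) (fun y => m.s y / 2) x := by
    simp only [div_eq_mul_inv]; exact h.s.mul mdifferentiableAt_const
  rw [D_add h2 h.d1, D_half h.s]

theorem Modes.MDiffAt.D_half_s_sub_d1 (h : m.MDiffAt x) (i : Fin 3) :
    D e i (fun y => m.s y / 2 - m.d1 y) x = D e i m.s x / 2 - D e i m.d1 x := by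
  have h2 : MDifferentiableAt (𝓡 3) 𝓘(ℝ, ℝ) (fun y => m.s y / 2) x := by
    simp only [div_eq_mul_inv]; exact h.s.mul mdifferentiableAt_const
  rw [D_sub h2 h.d1, D_half h.s]

theorem Modes.MDiffAt.D_half_t_add_d2 (h : m.MDiffAt x) (i : Fin 3) :
    D e i (fun y => m.t y / 2 + m.d2 y) x = D e i m.t x / 2 + D e i m.d2 x := by
  have h2 : MDifferentiableAt (𝓡 3) 𝓘(ℝ, ℝ) (fun y => m.t y / 2) x := by
    simp only [div_eq_mul_inv]; exact h.t.mul mdifferentiableAt_const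
  rw [D_add h2 h.d2, D_half h.t]

theorem Modes.MDiffAt.D_neg_half_t_add_d2 (h : m.MDiffAt x) (i : Fin 3) :
    D e i (fun y => -(m.t y / 2) + m.d2 y) x = -(D e i m.t x / 2) + D e i m.d2 x := by
  have h2 : MDifferentiableAt (𝓡 3) 𝓘(ℝ, ℝ) (fun y => m.t y / 2) x := by
    simp only [div_eq_mul_inv]; exact h.t.mul mdifferentiableAt_const
  have h3 : MDifferentiableAt (𝓡 3) 𝓘(ℝ, ℝ) (fun y => -(m.t y / 2)) x := h2.neg
  rw [D_add h3 h.d2, D_neg, D_half h.t]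

/-- With the denominator cleared and the derivative of Δ² expanded, later comparisons become
polynomial identities; the same holds for the next two lemmas. -/
theorem solvedK21_mul (h : m.MDiffAt x) (hD : m.Dsq x ≠ 0) :
    4 * m.Dsq x * solvedK21 e R m x =
      -2 * (m.d1 x * R 0 1 1 2 x + m.d2 x * R 0 2 1 2 x)
      + (m.d1 x * D e 1 m.t x - m.d2 x * D e 1 m.s x + m.d1 x * D e 2 m.s x + m.d2 x * D e 2 m.t x)
      - 2 * (m.d1 x * D e 1 m.d2 x - m.d2 x * D e 1 m.d1 x)
      + 2 * (m.d1 x * D e 2 m.d1 x + m.d2 x * D e 2 m.d2 x)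
      + 2 * m.t x * (m.bp x * m.d1 x + m.bx x * m.d2 x) := by
  rw [solvedK21, h.D_Dsq]
  field_simp
  ring

theorem solvedK32_mul (h : m.MDiffAt x) (hD : m.Dsq x ≠ 0) :
    4 * m.Dsq x * solvedK32 e R m x =
      -2 * (m.d1 x * R 0 2 1 2 x - m.d2 x * R 0 1 1 2 x)
      - (m.d2 x * D e 1 m.t x + m.d1 x * D e 1 m.s x - m.d1 x * D e 2 m.t x + m.d2 x * D e 2 m.s x)
      + 2 * (m.d1 x * D e 2 m.d2 x - m.d2 x * D e 2 m.d1 x)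
      + 2 * (m.d1 x * D e 1 m.d1 x + m.d2 x * D e 1 m.d2 x)
      - 2 * m.t x * (m.bp x * m.d2 x - m.bx x * m.d1 x) := by
  rw [solvedK32, h.D_Dsq]
  field_simp
  ring

theorem solvedW1_mul (hD : m.Dsq x ≠ 0) :
    16 * m.Dsq x * solvedW1 e R m x =
      4 * (m.d2 x * R 0 1 0 1 x - m.d2 x * R 0 2 0 2 x - m.d1 x * R 0 1 0 2 x
        - m.d1 x * R 0 2 0 1 x)
      + 2 * (m.bp x * R 0 1 1 2 x + m.bx x * R 0 2 1 2 x)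
      + 8 * (m.d2 x * D e 0 m.d1 x - m.d1 x * D e 0 m.d2 x)
      - 4 * (m.d1 x * D e 1 m.bx x + m.d1 x * D e 2 m.bp x - m.d2 x * D e 1 m.bp x
        + m.d2 x * D e 2 m.bx x)
      - 2 * m.t x * m.bsq x
      - 2 * (m.bx x * D e 1 m.d1 x - m.bp x * D e 1 m.d2 x + m.bp x * D e 2 m.d1 x
        + m.bx x * D e 2 m.d2 x)
      - (m.bp x * (D e 1 m.t x + D e 2 m.s x) + m.bx x * (D e 2 m.t x - D e 1 m.s x))
      + 4 * ((m.bp x ^ 2 - m.bx x ^ 2) * m.d2 x - 2 * m.bp x * m.bx x * m.d1 x) := by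
  rw [solvedW1]
  field_simp
  ring

/-- The part of the nine relations with curvature indices `1j`, which determines the auxiliary
fields algebraically. -/
structure SixRelations (e : Fin 3 → VField M) (R : Fin 3 → Fin 3 → Fin 3 → Fin 3 → M → ℝ)
    (m : Modes M) (k21 k32 w1 : ℝ) (x : M) : Prop where
  R1212 : R 0 1 0 1 x =
    -(D e 0 m.s x / 2 + D e 0 m.d1 x) - D e 1 m.bp x
      - m.bp x ^ 2 - m.s x ^ 2 / 4 + m.t x ^ 2 / 4 - m.s x * m.d1 x - m.Dsq x
      + 2 * w1 * m.d2 x + k21 * m.bx x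
  R1213 : R 0 1 0 2 x =
    -(-(D e 0 m.t x / 2) + D e 0 m.d2 x) - D e 2 m.bp x
      - m.bp x * m.bx x - m.s x * (-(m.t x / 2) + m.d2 x)
      - 2 * w1 * m.d1 x - k32 * m.bx x
  R1223 : R 0 1 1 2 x =
    -(-(D e 1 m.t x / 2) + D e 1 m.d2 x) + (D e 2 m.s x / 2 + D e 2 m.d1 x)
      + m.t x * m.bp x - 2 * k21 * m.d1 x + 2 * k32 * m.d2 x
  R1312 : R 0 2 0 1 x =
    -(D e 0 m.t x / 2 + D e 0 m.d2 x) - D e 1 m.bx x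
      - m.bp x * m.bx x - m.s x * (m.t x / 2 + m.d2 x)
      - 2 * w1 * m.d1 x - k21 * m.bp x
  R1313 : R 0 2 0 2 x =
    -(D e 0 m.s x / 2 - D e 0 m.d1 x) - D e 2 m.bx x
      - m.bx x ^ 2 - m.s x ^ 2 / 4 + m.t x ^ 2 / 4 + m.s x * m.d1 x - m.Dsq x
      - 2 * w1 * m.d2 x + k32 * m.bp x
  R1323 : R 0 2 1 2 x =
    -(D e 1 m.s x / 2 - D e 1 m.d1 x) + (D e 2 m.t x / 2 + D e 2 m.d2 x)
      + m.t x * m.bx x - 2 * k21 * m.d2 x - 2 * k32 * m.d1 x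

/-- The part of the nine relations with curvature indices `23`. -/
structure LastThreeRelations (e : Fin 3 → VField M) (R : Fin 3 → Fin 3 → Fin 3 → Fin 3 → M → ℝ)
    (m : Modes M) (a : Aux M) (x : M) : Prop where
  R2312 : R 1 2 0 1 x =
    -D e 0 a.k21 x + D e 1 a.w1 x - (m.bx x + a.k21 x) * (m.s x / 2 + m.d1 x)
      + (m.bp x + a.k32 x) * (m.t x / 2 + m.d2 x) + m.bp x * a.w1 x - a.k32 x * a.w1 x
  R2313 : R 1 2 0 2 x =
    D e 0 a.k32 x + D e 2 a.w1 x + (m.bp x + a.k32 x) * (m.s x / 2 - m.d1 x)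
      - (m.bx x + a.k21 x) * (-(m.t x / 2) + m.d2 x) + m.bx x * a.w1 x - a.k21 x * a.w1 x
  R2323 : R 1 2 1 2 x =
    D e 1 a.k32 x + D e 2 a.k21 x - a.k21 x ^ 2 - a.k32 x ^ 2 - m.t x * a.w1 x
      - m.s x ^ 2 / 4 - m.t x ^ 2 / 4 + m.Dsq x

/-- Linearity of the derivative is all that is used. The split separates relations that see only the
values of the auxiliary fields at `x`, and therefore take three numbers, from those that
differentiate these fields. -/
theorem nineRelations_iff (h : m.MDiffAt x) : NineRelations e R m a x ↔
    SixRelations e R m (a.k21 x) (a.k32 x) (a.w1 x) x ∧ LastThreeRelations e R m a x := by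
  constructor
  · rintro ⟨h1, h2, h3, h4, h5, h6, h7, h8, h9⟩
    simp only [h.D_half_s_add_d1, h.D_half_s_sub_d1, h.D_half_t_add_d2, h.D_neg_half_t_add_d2]
      at h1 h2 h3 h4 h5 h6
    exact ⟨⟨h1, h2, h3, h4, h5, h6⟩, ⟨h7, h8, h9⟩⟩
  · rintro ⟨⟨h1, h2, h3, h4, h5, h6⟩, ⟨h7, h8, h9⟩⟩
    simp only [← h.D_half_s_add_d1, ← h.D_half_s_sub_d1, ← h.D_half_t_add_d2,
      ← h.D_neg_half_t_add_d2] at h1 h2 h3 h4 h5 h6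
    exact ⟨h1, h2, h3, h4, h5, h6, h7, h8, h9⟩

/-- Agreement at `x` alone would not suffice, since the auxiliary fields are differentiated;
agreement on an open set does. -/
theorem LastThreeRelations.congr {a a' : Aux M} (hU : IsOpen U) (hx : x ∈ U)
    (h21 : ∀ y ∈ U, a.k21 y = a'.k21 y) (h32 : ∀ y ∈ U, a.k32 y = a'.k32 y)
    (hw : ∀ y ∈ U, a.w1 y = a'.w1 y) (h : LastThreeRelations e R m a x) :
    LastThreeRelations e R m a' x := by
  obtain ⟨h1, h2, h3⟩ := h
  rw [D_congr_of_eqOn hU hx h21, D_congr_of_eqOn hU hx hw, h21 x hx, h32 x hx, hw x hx] at h1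
  rw [D_congr_of_eqOn hU hx h32, D_congr_of_eqOn hU hx hw, h21 x hx, h32 x hx, hw x hx] at h2
  rw [D_congr_of_eqOn hU hx h32, D_congr_of_eqOn hU hx h21, h21 x hx, h32 x hx, hw x hx] at h3
  exact ⟨h1, h2, h3⟩

theorem secondOrderRelations_iff :
    SecondOrderRelations e R m x ↔ LastThreeRelations e R m (solved e R m) x :=
  ⟨fun h => ⟨h.1, h.2, h.3⟩, fun h => ⟨h.1, h.2, h.3⟩⟩

/-- The six equations are replaced by six linear combinations of them, and the change of basis is
invertible because Δ² ≠ 0. Three combinations isolate an auxiliary value, the other three are the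
first-order relations; `hR` turns R_{1312} - R_{1213} into the zero of `diff`. -/
theorem sixRelations_iff (h : m.MDiffAt x) (hD : m.Dsq x ≠ 0) (hR : R 0 1 0 2 x = R 0 2 0 1 x)
    (k21 k32 w1 : ℝ) : SixRelations e R m k21 k32 w1 x ↔
      k21 = solvedK21 e R m x ∧ k32 = solvedK32 e R m x ∧ w1 = solvedW1 e R m x ∧
        FirstOrderRelations e R m x := by
  have e1 := solvedK21_mul (e := e) (R := R) h hD
  have e2 := solvedK32_mul (e := e) (R := R) h hD
  have e3 := solvedW1_mul (e := e) (R := R) hD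
  have hD' : m.Dsq x = m.d1 x ^ 2 + m.d2 x ^ 2 := rfl
  have hb : m.bsq x = m.bp x ^ 2 + m.bx x ^ 2 := rfl
  constructor
  · rintro ⟨h1, h2, h3, h4, h5, h6⟩
    have h21 : k21 = solvedK21 e R m x := by
      refine mul_left_cancel₀ (mul_ne_zero four_ne_zero hD) ?_
      linear_combination 2 * m.d1 x * h3 + 2 * m.d2 x * h6 - e1 + 4 * k21 * hD'
    have h32 : k32 = solvedK32 e R m x := by
      refine mul_left_cancel₀ (mul_ne_zero four_ne_zero hD) ?_
      linear_combination 2 * m.d1 x * h6 - 2 * m.d2 x * h3 - e2 + 4 * k32 * hD'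
    have hw : w1 = solvedW1 e R m x := by
      refine mul_left_cancel₀ (mul_ne_zero (by norm_num : (16 : ℝ) ≠ 0) hD) ?_
      -- The first four terms isolate ω₁ but leave multiples of κ₂¹ and κ₃²; these are exactly
      -- cancelled by the combination of R_{1223} and R_{1323} with coefficients b_⊥ and b_×.
      linear_combination -4 * m.d2 x * h1 + 4 * m.d2 x * h5 + 4 * m.d1 x * h2 + 4 * m.d1 x * h4
        - 2 * m.bp x * h3 - 2 * m.bx x * h6 - e3 + 16 * w1 * hD' + 2 * m.t x * hb
    refine ⟨h21, h32, hw, ?_⟩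
    subst h21 h32 hw
    refine ⟨?_, ?_, ?_⟩
    · linear_combination h1 + h5 + hb
    · linear_combination h4 - h2 + hR
    · rw [h.D_Dsq]
      field_simp
      linear_combination m.d1 x * (h1 - h5) + m.d2 x * (h2 + h4) + 2 * m.s x * hD'
  · rintro ⟨rfl, rfl, rfl, f1, f2, f3⟩
    rw [h.D_Dsq] at f3
    field_simp at f3
    have h3 : R 0 1 1 2 x =
        -(-(D e 1 m.t x / 2) + D e 1 m.d2 x) + (D e 2 m.s x / 2 + D e 2 m.d1 x)
          + m.t x * m.bp x - 2 * solvedK21 e R m x * m.d1 x + 2 * solvedK32 e R m x * m.d2 x := by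
      refine mul_left_cancel₀ (mul_ne_zero two_ne_zero hD) ?_
      linear_combination m.d1 x * e1 - m.d2 x * e2 + (2 * R 0 1 1 2 x - D e 1 m.t x - D e 2 m.s x
        + 2 * D e 1 m.d2 x - 2 * D e 2 m.d1 x - 2 * m.t x * m.bp x) * hD'
    have h6 : R 0 2 1 2 x =
        -(D e 1 m.s x / 2 - D e 1 m.d1 x) + (D e 2 m.t x / 2 + D e 2 m.d2 x)
          + m.t x * m.bx x - 2 * solvedK21 e R m x * m.d2 x - 2 * solvedK32 e R m x * m.d1 x := by
      refine mul_left_cancel₀ (mul_ne_zero two_ne_zero hD) ?_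
      linear_combination m.d2 x * e1 + m.d1 x * e2 + (2 * R 0 2 1 2 x + D e 1 m.s x - D e 2 m.t x
        - 2 * D e 1 m.d1 x - 2 * D e 2 m.d2 x - 2 * m.t x * m.bx x) * hD'
    -- The defects of the four remaining equations are named. The ω₁ formula and the splay relation
    -- say that (r1 - r5, r2 + r4) is annihilated by a matrix of determinant ±Δ², and the other two
    -- relations that r1 + r5 and r2 - r4 vanish.
    obtain ⟨r1, hr1⟩ : ∃ r, r = R 0 1 0 1 x - (-(D e 0 m.s x / 2 + D e 0 m.d1 x) - D e 1 m.bp x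
      - m.bp x ^ 2 - m.s x ^ 2 / 4 + m.t x ^ 2 / 4 - m.s x * m.d1 x - m.Dsq x
      + 2 * solvedW1 e R m x * m.d2 x + solvedK21 e R m x * m.bx x) := ⟨_, rfl⟩
    obtain ⟨r2, hr2⟩ : ∃ r, r = R 0 1 0 2 x - (-(-(D e 0 m.t x / 2) + D e 0 m.d2 x) - D e 2 m.bp x
      - m.bp x * m.bx x - m.s x * (-(m.t x / 2) + m.d2 x)
      - 2 * solvedW1 e R m x * m.d1 x - solvedK32 e R m x * m.bx x) := ⟨_, rfl⟩
    obtain ⟨r4, hr4⟩ : ∃ r, r = R 0 2 0 1 x - (-(D e 0 m.t x / 2 + D e 0 m.d2 x) - D e 1 m.bx x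
      - m.bp x * m.bx x - m.s x * (m.t x / 2 + m.d2 x)
      - 2 * solvedW1 e R m x * m.d1 x - solvedK21 e R m x * m.bp x) := ⟨_, rfl⟩
    obtain ⟨r5, hr5⟩ : ∃ r, r = R 0 2 0 2 x - (-(D e 0 m.s x / 2 - D e 0 m.d1 x) - D e 2 m.bx x
      - m.bx x ^ 2 - m.s x ^ 2 / 4 + m.t x ^ 2 / 4 + m.s x * m.d1 x - m.Dsq x
      - 2 * solvedW1 e R m x * m.d2 x + solvedK32 e R m x * m.bp x) := ⟨_, rfl⟩
    have g1 : m.d2 x * (r1 - r5) - m.d1 x * (r2 + r4) = 0 := by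
      rw [hr1, hr2, hr4, hr5]
      linear_combination (-1 / 4) * e3 - m.bp x / 2 * h3 - m.bx x / 2 * h6
        + 4 * solvedW1 e R m x * hD' + m.t x / 2 * hb
    have g2 : m.d1 x * (r1 - r5) + m.d2 x * (r2 + r4) = 0 := by
      rw [hr1, hr2, hr4, hr5]
      linear_combination f3 - 2 * m.s x * hD'
    have g3 : r1 + r5 = 0 := by
      rw [hr1, hr5]
      linear_combination f1 - hb
    have g4 : r2 - r4 = 0 := by
      rw [hr2, hr4]
      linear_combination hR - f2
    have g5 : r1 - r5 = 0 := by
      refine (mul_eq_zero.1 ?_).resolve_left hD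
      linear_combination m.d2 x * g1 + m.d1 x * g2 + (r1 - r5) * hD'
    have g6 : r2 + r4 = 0 := by
      refine (mul_eq_zero.1 ?_).resolve_left hD
      linear_combination m.d2 x * g2 - m.d1 x * g1 + (r2 + r4) * hD'
    refine ⟨?_, ?_, h3, ?_, ?_, h6⟩
    · linear_combination (g3 + g5) / 2 - hr1
    · linear_combination (g4 + g6) / 2 - hr2
    · linear_combination (g6 - g4) / 2 - hr4
    · linear_combination (g3 - g5) / 2 - hr5

theorem forall_nineRelations_iff (hU : IsOpen U) (h : ∀ x ∈ U, m.MDiffAt x)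
    (hR : ∀ x ∈ U, R 0 1 0 2 x = R 0 2 0 1 x) (hD : ∀ x ∈ U, m.Dsq x ≠ 0) :
    (∀ x ∈ U, NineRelations e R m a x) ↔
      ∀ x ∈ U, a.k21 x = solvedK21 e R m x ∧ a.k32 x = solvedK32 e R m x ∧
        a.w1 x = solvedW1 e R m x ∧ FirstOrderRelations e R m x ∧
        SecondOrderRelations e R m x := by
  constructor
  · intro H
    have key := fun x hx => (sixRelations_iff (h x hx) (hD x hx) (hR x hx) _ _ _).1
      ((nineRelations_iff (h x hx)).1 (H x hx)).1
    intro x hx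
    obtain ⟨h1, h2, h3, h4⟩ := key x hx
    refine ⟨h1, h2, h3, h4, secondOrderRelations_iff.2 ?_⟩
    exact ((nineRelations_iff (h x hx)).1 (H x hx)).2.congr hU hx (fun y hy => (key y hy).1)
      (fun y hy => (key y hy).2.1) (fun y hy => (key y hy).2.2.1)
  · intro H x hx
    obtain ⟨h1, h2, h3, h4, h5⟩ := H x hx
    refine (nineRelations_iff (h x hx)).2
      ⟨(sixRelations_iff (h x hx) (hD x hx) (hR x hx) _ _ _).2 ⟨h1, h2, h3, h4⟩, ?_⟩
    exact (secondOrderRelations_iff.1 h5).congr hU hx (fun y hy => (H y hy).1.symm)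
      (fun y hy => (H y hy).2.1.symm) (fun y hy => (H y hy).2.2.1.symm)

/-! ### Vanishing biaxial splay -/

theorem solvedK21₀_mul (hb : m.bsq x ≠ 0) :
    4 * m.bsq x * solvedK21₀ e R m x =
      4 * (m.bx x * R 0 1 0 1 x - m.bp x * R 0 2 0 1 x)
      + 2 * (m.bx x * D e 0 m.s x - m.bp x * D e 0 m.t x)
      - 4 * (m.bp x * D e 1 m.bx x - m.bx x * D e 1 m.bp x)
      - ((m.t x ^ 2 - m.s x ^ 2) * m.bx x + 2 * m.s x * m.t x * m.bp x) := by
  rw [solvedK21₀]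
  field_simp
  ring

theorem solvedK32₀_mul (hb : m.bsq x ≠ 0) :
    4 * m.bsq x * solvedK32₀ e R m x =
      4 * (m.bp x * R 0 2 0 2 x - m.bx x * R 0 1 0 2 x)
      + 2 * (m.bx x * D e 0 m.t x + m.bp x * D e 0 m.s x)
      + 4 * (m.bp x * D e 2 m.bx x - m.bx x * D e 2 m.bp x)
      + ((m.s x ^ 2 - m.t x ^ 2) * m.bp x + 2 * m.s x * m.t x * m.bx x) := by
  rw [solvedK32₀]
  field_simp
  ring

/-- With Δ and its derivatives zero, R_{1212} and R_{1312} contain κ₂¹ with coefficients (b_×,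
-b_⊥), and R_{1213} and R_{1313} contain κ₃² with coefficients (-b_×, b_⊥). Projecting each pair
onto its coefficient vector solves for the unknown; projecting onto (b_⊥, b_×) gives a relation free
of it. The two projections recover the pair since b² ≠ 0. -/
theorem sixRelations_iff₀ (hD : m.Dsq x = 0) (hd1 : ∀ i, D e i m.d1 x = 0)
    (hd2 : ∀ i, D e i m.d2 x = 0) (hb : m.bsq x ≠ 0) (k21 k32 w1 : ℝ) :
    SixRelations e R m k21 k32 w1 x ↔
      k21 = solvedK21₀ e R m x ∧ k32 = solvedK32₀ e R m x ∧ FirstOrderRelations₀ e R m x := by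
  have e1 := solvedK21₀_mul (e := e) (R := R) hb
  have e2 := solvedK32₀_mul (e := e) (R := R) hb
  have hb' : m.bsq x = m.bp x ^ 2 + m.bx x ^ 2 := rfl
  have z1 := Modes.d1_eq_zero hD
  have z2 := Modes.d2_eq_zero hD
  constructor
  · rintro ⟨h1, h2, h3, h4, h5, h6⟩
    rw [z1, z2, hd1, hD] at h1 h5
    rw [z1, z2, hd2] at h2 h4
    rw [z1, z2, hd1, hd2] at h3 h6
    refine ⟨?_, ?_, ?_, ?_, ?_, ?_⟩
    · refine mul_left_cancel₀ (mul_ne_zero four_ne_zero hb) ?_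
      linear_combination 4 * m.bp x * h4 - 4 * m.bx x * h1 - e1 + 4 * k21 * hb'
    · refine mul_left_cancel₀ (mul_ne_zero four_ne_zero hb) ?_
      linear_combination 4 * m.bx x * h2 - 4 * m.bp x * h5 - e2 + 4 * k32 * hb'
    · linear_combination m.bp x * h1 + m.bx x * h4 + m.bp x * hb'
    · linear_combination m.bp x * h2 + m.bx x * h5 + m.bx x * hb'
    · linear_combination h3
    · linear_combination h6
  · rintro ⟨rfl, rfl, f1, f2, f3, f4⟩
    refine ⟨?_, ?_, ?_, ?_, ?_, ?_⟩ <;> rw [z1, z2]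
    · rw [hd1, hD]
      refine mul_left_cancel₀ (mul_ne_zero four_ne_zero hb) ?_
      linear_combination 4 * m.bp x * f1 - m.bx x * e1 + (4 * R 0 1 0 1 x + 2 * D e 0 m.s x
        + 4 * D e 1 m.bp x + m.s x ^ 2 - m.t x ^ 2) * hb'
    · rw [hd2]
      refine mul_left_cancel₀ (mul_ne_zero four_ne_zero hb) ?_
      linear_combination 4 * m.bp x * f2 + m.bx x * e2 + (4 * R 0 1 0 2 x - 2 * D e 0 m.t x
        + 4 * D e 2 m.bp x - 2 * m.s x * m.t x) * hb'
    · rw [hd1, hd2]; linear_combination f3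
    · rw [hd2]
      refine mul_left_cancel₀ (mul_ne_zero four_ne_zero hb) ?_
      linear_combination 4 * m.bx x * f1 + m.bp x * e1 + (4 * R 0 2 0 1 x + 2 * D e 0 m.t x
        + 4 * D e 1 m.bx x + 2 * m.s x * m.t x) * hb'
    · rw [hd1, hD]
      refine mul_left_cancel₀ (mul_ne_zero four_ne_zero hb) ?_
      linear_combination 4 * m.bx x * f2 - m.bp x * e2 + (4 * R 0 2 0 2 x + 2 * D e 0 m.s x
        + 4 * D e 2 m.bx x + m.s x ^ 2 - m.t x ^ 2) * hb'
    · rw [hd1, hd2]; linear_combination f4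

theorem lastThreeRelations_iff₀ (hD : m.Dsq x = 0) (w : M → ℝ) :
    LastThreeRelations e R m ⟨solvedK21₀ e R m, solvedK32₀ e R m, w⟩ x ↔
      LastTwoRelations₀ e R m w x ∧ RelationR2323₀ e R m w x := by
  have z1 := Modes.d1_eq_zero hD
  have z2 := Modes.d2_eq_zero hD
  constructor
  · rintro ⟨h1, h2, h3⟩
    simp only [z1, z2, hD, add_zero, sub_zero] at h1 h2 h3
    exact ⟨⟨h1, h2⟩, h3⟩
  · rintro ⟨⟨h1, h2⟩, h3⟩
    constructor <;> simp only [z1, z2, hD, add_zero, sub_zero]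
    exacts [h1, h2, h3]

theorem LastTwoRelations₀.congr {w w' : M → ℝ} (hU : IsOpen U) (hx : x ∈ U)
    (hw : ∀ y ∈ U, w y = w' y) (h : LastTwoRelations₀ e R m w x) :
    LastTwoRelations₀ e R m w' x := by
  obtain ⟨h1, h2⟩ := h
  rw [D_congr_of_eqOn hU hx hw, hw x hx] at h1 h2
  exact ⟨h1, h2⟩

theorem relationR2323₀_iff (ht : m.t x ≠ 0) (w : M → ℝ) :
    RelationR2323₀ e R m w x ↔ w x = solvedW1₀ e R m x := by
  rw [RelationR2323₀, solvedW1₀, eq_div_iff ht]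
  constructor <;> intro h <;> linear_combination h

theorem forall_nineRelations_iff₀ (hU : IsOpen U) (h : ∀ x ∈ U, m.MDiffAt x)
    (hD : ∀ x ∈ U, m.Dsq x = 0) (hb : ∀ x ∈ U, m.bsq x ≠ 0) :
    (∀ x ∈ U, NineRelations e R m a x) ↔
      ∀ x ∈ U, a.k21 x = solvedK21₀ e R m x ∧ a.k32 x = solvedK32₀ e R m x ∧
        FirstOrderRelations₀ e R m x ∧ LastTwoRelations₀ e R m a.w1 x ∧
        RelationR2323₀ e R m a.w1 x := by
  have hd1 : ∀ x ∈ U, ∀ i, D e i m.d1 x = 0 := fun x hx i =>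
    D_zero_of_eqOn hU hx fun y hy => Modes.d1_eq_zero (hD y hy)
  have hd2 : ∀ x ∈ U, ∀ i, D e i m.d2 x = 0 := fun x hx i =>
    D_zero_of_eqOn hU hx fun y hy => Modes.d2_eq_zero (hD y hy)
  have six := fun x hx => sixRelations_iff₀ (R := R) (hD x hx) (hd1 x hx) (hd2 x hx) (hb x hx)
    (a.k21 x) (a.k32 x) (a.w1 x)
  constructor
  · intro H
    have key := fun x hx => (six x hx).1 ((nineRelations_iff (h x hx)).1 (H x hx)).1
    intro x hx
    obtain ⟨h1, h2, h3⟩ := key x hx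
    refine ⟨h1, h2, h3, (lastThreeRelations_iff₀ (hD x hx) a.w1).1 ?_⟩
    exact ((nineRelations_iff (h x hx)).1 (H x hx)).2.congr hU hx (fun y hy => (key y hy).1)
      (fun y hy => (key y hy).2.1) (fun y hy => rfl)
  · intro H x hx
    obtain ⟨h1, h2, h3, h4⟩ := H x hx
    refine (nineRelations_iff (h x hx)).2 ⟨(six x hx).2 ⟨h1, h2, h3⟩, ?_⟩
    exact LastThreeRelations.congr (a := ⟨solvedK21₀ e R m, solvedK32₀ e R m, a.w1⟩) hU hx
      (fun y hy => (H y hy).1.symm) (fun y hy => (H y hy).2.1.symm) (fun y hy => rfl)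
      ((lastThreeRelations_iff₀ (hD x hx) a.w1).2 h4)

theorem forall_nineRelations_iff₀_of_twist_ne_zero (hU : IsOpen U) (h : ∀ x ∈ U, m.MDiffAt x)
    (hD : ∀ x ∈ U, m.Dsq x = 0) (hb : ∀ x ∈ U, m.bsq x ≠ 0) (ht : ∀ x ∈ U, m.t x ≠ 0) :
    (∀ x ∈ U, NineRelations e R m a x) ↔
      ∀ x ∈ U, a.k21 x = solvedK21₀ e R m x ∧ a.k32 x = solvedK32₀ e R m x ∧
        a.w1 x = solvedW1₀ e R m x ∧ FirstOrderRelations₀ e R m x ∧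
        LastTwoRelations₀ e R m (solvedW1₀ e R m) x := by
  rw [forall_nineRelations_iff₀ hU h hD hb]
  constructor
  · intro H
    have hw := fun x hx => (relationR2323₀_iff (ht x hx) a.w1).1 (H x hx).2.2.2.2
    intro x hx
    obtain ⟨h1, h2, h3, h4, -⟩ := H x hx
    exact ⟨h1, h2, hw x hx, h3, h4.congr hU hx hw⟩
  · intro H x hx
    obtain ⟨h1, h2, h3, h4, h5⟩ := H x hx
    exact ⟨h1, h2, h4, h5.congr hU hx fun y hy => (H y hy).2.2.1.symm,
      (relationR2323₀_iff (ht x hx) a.w1).2 h3⟩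

/-- When Δ and b vanish identically, R_{1212} and R_{1313} have the same right-hand side, while
those of R_{1213} and R_{1312} are opposite; the pair symmetry then makes the latter two zero. -/
theorem riem_eq_of_Dsq_eq_zero_of_bsq_eq_zero (hU : IsOpen U) (h : ∀ x ∈ U, m.MDiffAt x)
    (hD : ∀ x ∈ U, m.Dsq x = 0) (hb : ∀ x ∈ U, m.bsq x = 0)
    (H : ∀ x ∈ U, NineRelations e R m a x) (hR : ∀ x ∈ U, R 0 1 0 2 x = R 0 2 0 1 x)
    (hx : x ∈ U) : R 0 1 0 1 x = R 0 2 0 2 x ∧ R 0 1 0 2 x = 0 ∧ R 0 2 0 1 x = 0 := by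
  have hbp : ∀ y ∈ U, m.bp y = 0 := fun y hy => by
    have : m.bp y ^ 2 + m.bx y ^ 2 = 0 := hb y hy
    nlinarith [sq_nonneg (m.bp y), sq_nonneg (m.bx y)]
  have hbx : ∀ y ∈ U, m.bx y = 0 := fun y hy => by
    have : m.bp y ^ 2 + m.bx y ^ 2 = 0 := hb y hy
    nlinarith [sq_nonneg (m.bp y), sq_nonneg (m.bx y)]
  have z1 := fun y hy => Modes.d1_eq_zero (hD y hy)
  have z2 := fun y hy => Modes.d2_eq_zero (hD y hy)
  obtain ⟨h1, h2, h3, h4, h5, h6⟩ := ((nineRelations_iff (h x hx)).1 (H x hx)).1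
  rw [D_zero_of_eqOn hU hx hbp, hbp x hx, hbx x hx, z1 x hx, z2 x hx,
    D_zero_of_eqOn hU hx z1] at h1
  rw [D_zero_of_eqOn hU hx hbx, hbp x hx, hbx x hx, z1 x hx, z2 x hx,
    D_zero_of_eqOn hU hx z1] at h5
  rw [D_zero_of_eqOn hU hx hbp, hbp x hx, hbx x hx, z1 x hx, z2 x hx,
    D_zero_of_eqOn hU hx z2] at h2
  rw [D_zero_of_eqOn hU hx hbx, hbp x hx, hbx x hx, z1 x hx, z2 x hx,
    D_zero_of_eqOn hU hx z2] at h4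
  have hR' := hR x hx
  refine ⟨?_, ?_, ?_⟩
  · linear_combination h1 - h5
  · linear_combination (h2 + h4 + hR') / 2
  · linear_combination (h2 + h4 - hR') / 2

end FieldAlgebra

/-! ### Differentiable vector fields and the rules of the covariant derivative. -/

section Sections

variable {M : Type*} [TopologicalSpace M] [ChartedSpace (EuclideanSpace ℝ (Fin 3)) M]
  [IsManifold (𝓡 3) ∞ M] {e : Fin 3 → VField M} {U : Set M} {x : M}

/-- `V` is differentiable at `x` as a section of the tangent bundle. -/
abbrev VDiffAt (V : VField M) (x : M) : Prop :=
  MDifferentiableAt (𝓡 3) ((𝓡 3).prod 𝓘(ℝ, EuclideanSpace ℝ (Fin 3)))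
    (fun x => Bundle.TotalSpace.mk' (EuclideanSpace ℝ (Fin 3)) x (V x)) x

/-- `V` is smooth at `x` as a section of the tangent bundle. -/
abbrev VSmoothAt (V : VField M) (x : M) : Prop :=
  ContMDiffAt (𝓡 3) ((𝓡 3).prod 𝓘(ℝ, EuclideanSpace ℝ (Fin 3))) ∞
    (fun x => Bundle.TotalSpace.mk' (EuclideanSpace ℝ (Fin 3)) x (V x)) x

theorem VSmoothAt.vDiffAt {V : VField M} (h : VSmoothAt V x) : VDiffAt V x :=
  h.mdifferentiableAt (by simp)

theorem VDiffAt.smul {V : VField M} {f : M → ℝ} (hV : VDiffAt V x)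
    (hf : MDifferentiableAt (𝓡 3) 𝓘(ℝ, ℝ) f x) : VDiffAt (fun y => f y • V y) x :=
  hf.smul_section hV

theorem VDiffAt.add {V W : VField M} (hV : VDiffAt V x) (hW : VDiffAt W x) :
    VDiffAt (fun y => V y + W y) x :=
  mdifferentiableAt_add_section hV hW

theorem VDiffAt.sum_smul {f : Fin 3 → M → ℝ}
    (hf : ∀ p, MDifferentiableAt (𝓡 3) 𝓘(ℝ, ℝ) (f p) x) (he : ∀ p, VDiffAt (e p) x) :
    VDiffAt (fun y => ∑ p, f p y • e p y) x := by
  have h := fun p => (he p).smul (hf p)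
  simp only [Fin.sum_univ_three]
  exact ((h 0).add (h 1)).add (h 2)

theorem VDiffAt.congr {V W : VField M} (hV : VDiffAt V x) (hU : IsOpen U) (hx : x ∈ U)
    (h : ∀ y ∈ U, W y = V y) : VDiffAt W x :=
  MDifferentiableAt.congr_of_eventuallyEq hV
    (Filter.eventuallyEq_of_mem (hU.mem_nhds hx) fun y hy => by simp only [h y hy])

variable {nabla : CovariantDerivative (𝓡 3) (EuclideanSpace ℝ (Fin 3))
  (fun x : M => TangentSpace (𝓡 3) x)}

theorem nabla_add {V W : VField M} (hV : VDiffAt V x) (hW : VDiffAt W x) :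
    nabla (fun y => V y + W y) x = nabla V x + nabla W x :=
  nabla.isCovariantDerivativeOnUniv.add hV hW

theorem nabla_smul {V : VField M} {f : M → ℝ} (hV : VDiffAt V x)
    (hf : MDifferentiableAt (𝓡 3) 𝓘(ℝ, ℝ) f x) (v : TangentSpace (𝓡 3) x) :
    nabla (fun y => f y • V y) x v = f x • nabla V x v + mvfderiv (𝓡 3) f x v • V x := by
  have h := congrArg (fun L => L v) (nabla.isCovariantDerivativeOnUniv.leibniz hV hf)
  simp only [add_apply, smul_apply, ContinuousLinearMap.smulRight_apply] at h
  exact h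

/-- This is what permits replacing a field by its expansion in the frame, which is valid only on
`U`. -/
theorem nabla_congr {V W : VField M} (hV : VDiffAt V x) (hW : VDiffAt W x) (hU : IsOpen U)
    (hx : x ∈ U) (h : ∀ y ∈ U, V y = W y) : nabla V x = nabla W x :=
  nabla.isCovariantDerivativeOnUniv.congr_of_eventuallyEq hV hW Filter.univ_mem
    (Filter.eventually_of_mem (hU.mem_nhds hx) h)

theorem nabla_sum_smul {f : Fin 3 → M → ℝ}
    (hf : ∀ p, MDifferentiableAt (𝓡 3) 𝓘(ℝ, ℝ) (f p) x) (he : ∀ p, VDiffAt (e p) x)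
    (v : TangentSpace (𝓡 3) x) :
    nabla (fun y => ∑ p, f p y • e p y) x v =
      ∑ p, (f p x • nabla (e p) x v + mvfderiv (𝓡 3) (f p) x v • e p x) := by
  have h := fun p => (he p).smul (hf p)
  simp only [Fin.sum_univ_three]
  rw [nabla_add ((h 0).add (h 1)) (h 2), nabla_add (h 0) (h 1)]
  simp only [add_apply, nabla_smul (he _) (hf _)]

end Sections

theorem coframe_apply {M : Type*} [TopologicalSpace M]
    [ChartedSpace (EuclideanSpace ℝ (Fin 3)) M]
    [RiemannianBundle (fun x : M => TangentSpace (𝓡 3) x)] {e : Fin 3 → VField M} {x : M}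
    (i : Fin 3) (v : TangentSpace (𝓡 3) x) : coframe e i x v = inner ℝ (e i x) v := rfl

/-! ### Connection coefficients and curvature in an orthonormal frame. -/

section Frame

variable {M : Type*} [TopologicalSpace M] [ChartedSpace (EuclideanSpace ℝ (Fin 3)) M]
  [IsManifold (𝓡 3) ∞ M] [RiemannianBundle (fun x : M => TangentSpace (𝓡 3) x)]
  {e : Fin 3 → VField M} {U : Set M} {x : M}
  {nabla : CovariantDerivative (𝓡 3) (EuclideanSpace ℝ (Fin 3))
  (fun x : M => TangentSpace (𝓡 3) x)}

theorem IsOrthonormalFrameOn.smoothAt (he : IsOrthonormalFrameOn e U) (hU : IsOpen U) (hx : x ∈ U)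
    (i : Fin 3) : VSmoothAt (e i) x :=
  (he.contMDiffOn i).contMDiffAt (hU.mem_nhds hx)

theorem IsOrthonormalFrameOn.inner_eq (he : IsOrthonormalFrameOn e U) (hx : x ∈ U) (i j : Fin 3) :
    inner ℝ (e i x) (e j x) = if i = j then (1 : ℝ) else 0 :=
  orthonormal_iff_ite.1 (he.orthonormal x hx) i j

theorem IsOrthonormalFrameOn.exists_orthonormalBasis (he : IsOrthonormalFrameOn e U)
    (hx : x ∈ U) : ∃ b : OrthonormalBasis (Fin 3) ℝ (TangentSpace (𝓡 3) x), ∀ i, b i = e i x := by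
  have h := he.orthonormal x hx
  have hcard : Fintype.card (Fin 3) = Module.finrank ℝ (TangentSpace (𝓡 3) x) := by
    -- The tangent space is by definition the model space, so its dimension is 3.
    rw [show Module.finrank ℝ (TangentSpace (𝓡 3) x) =
      Module.finrank ℝ (EuclideanSpace ℝ (Fin 3)) from rfl]
    simp
  have hb := coe_basisOfOrthonormalOfCardEqFinrank h hcard
  refine ⟨(basisOfOrthonormalOfCardEqFinrank h hcard).toOrthonormalBasis (by rw [hb]; exact h),
    fun i => ?_⟩
  rw [Module.Basis.coe_toOrthonormalBasis, hb]

theorem IsOrthonormalFrameOn.sum_inner_smul (he : IsOrthonormalFrameOn e U) (hx : x ∈ U)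
    (v : TangentSpace (𝓡 3) x) : v = ∑ p, (inner ℝ v (e p x) : ℝ) • e p x := by
  obtain ⟨b, hb⟩ := he.exists_orthonormalBasis hx
  conv_lhs => rw [← b.sum_repr' v]
  simp only [hb, real_inner_comm]

/-- The components `⟨∇_{n_k} n_i, n_j⟩` of the connection forms. -/
def gam (nabla : CovariantDerivative (𝓡 3) (EuclideanSpace ℝ (Fin 3))
    (fun x : M => TangentSpace (𝓡 3) x)) (e : Fin 3 → VField M) (k i j : Fin 3) (x : M) : ℝ :=
  inner ℝ (nabla (e i) x (e k x)) (e j x)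

theorem connForm_apply (i j k : Fin 3) :
    connForm nabla e i j x (e k x) = gam nabla e k i j x := by
  simp [connForm, gam, real_inner_comm]

theorem IsOrthonormalFrameOn.nabla_eq (he : IsOrthonormalFrameOn e U) (hx : x ∈ U) (k i : Fin 3) :
    nabla (e i) x (e k x) = ∑ p, gam nabla e k i p x • e p x :=
  he.sum_inner_smul hx _

theorem IsOrthonormalFrameOn.coframe_frame (he : IsOrthonormalFrameOn e U) (hx : x ∈ U)
    (i k : Fin 3) : coframe e i x (e k x) = if i = k then 1 else 0 :=
  he.inner_eq hx i k

theorem IsOrthonormalFrameOn.eq_sum_coframe (he : IsOrthonormalFrameOn e U) (hx : x ∈ U)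
    (α : TangentSpace (𝓡 3) x →L[ℝ] ℝ) (v : TangentSpace (𝓡 3) x) :
    α v = ∑ p, α (e p x) * coframe e p x v := by
  conv_lhs => rw [he.sum_inner_smul hx v]
  simp only [map_sum, map_smul, smul_eq_mul, coframe_apply]
  exact Finset.sum_congr rfl fun p _ => by rw [real_inner_comm, mul_comm]

theorem riem_antisymm_right (i j k l : Fin 3) :
    riem nabla e i j k l x = -riem nabla e i j l k x := by
  rw [riem, riem, ← inner_neg_left]
  congr 1
  rw [curvOp, curvOp, VectorField.mlieBracket_swap_apply, map_neg]
  abel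

theorem IsOrthonormalFrameOn.trace_eq (he : IsOrthonormalFrameOn e U) (hx : x ∈ U)
    (A : TangentSpace (𝓡 3) x →ₗ[ℝ] TangentSpace (𝓡 3) x) :
    LinearMap.trace ℝ _ A = ∑ p, (inner ℝ (A (e p x)) (e p x) : ℝ) := by
  obtain ⟨b, hb⟩ := he.exists_orthonormalBasis hx
  simp only [A.trace_eq_sum_inner b, hb, real_inner_comm]

theorem modes_bp : (modes nabla e).bp x = -gam nabla e 0 0 1 x := by
  simp [modes, bendVec, gam]

theorem modes_bx : (modes nabla e).bx x = -gam nabla e 0 0 2 x := by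
  simp [modes, bendVec, gam]

theorem modes_t : (modes nabla e).t x = gam nabla e 1 0 2 x - gam nabla e 2 0 1 x := rfl

/-- The structure functions `⟨[n_k, n_l], n_p⟩` of the frame. -/
def structFun (e : Fin 3 → VField M) (k l p : Fin 3) (x : M) : ℝ :=
  inner ℝ (VectorField.mlieBracket (𝓡 3) (e k) (e l) x) (e p x)

theorem aux_w1 : (aux nabla e).w1 x = gam nabla e 0 1 2 x := rfl

theorem IsOrthonormalFrameOn.modes_d2 (he : IsOrthonormalFrameOn e U) (hx : x ∈ U) :
    (modes nabla e).d2 x = (gam nabla e 1 0 2 x + gam nabla e 2 0 1 x) / 2 := by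
  have h1 : (modes nabla e).d2 x = (gam nabla e 1 0 2 x + gam nabla e 2 0 1 x) / 2
    - (modes nabla e).s x / 2 * inner ℝ (e 1 x) (e 2 x) := rfl
  rw [h1, he.inner_eq hx]
  simp

theorem aux_k21 : (aux nabla e).k21 x = gam nabla e 1 1 2 x := rfl

theorem IsOrthonormalFrameOn.mlieBracket_smoothAt (he : IsOrthonormalFrameOn e U) (hU : IsOpen U)
    (hx : x ∈ U) (k l : Fin 3) : VSmoothAt (VectorField.mlieBracket (𝓡 3) (e k) (e l)) x := by
  have : IsManifold (𝓡 3) (minSmoothness ℝ 2) M := by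
    rw [minSmoothness_of_isRCLikeNormedField]; infer_instance
  -- The bracket costs one derivative, which is harmless because ∞ + 1 is ∞ by computation.
  have : IsManifold (𝓡 3) (((⊤ : ℕ∞) : WithTop ℕ∞) + 1) M := ‹IsManifold (𝓡 3) ∞ M›
  exact ContMDiffAt.mlieBracket_vectorField (m := ⊤) (n := ⊤) (he.smoothAt hU hx k)
    (he.smoothAt hU hx l) (by simp)

variable [IsContMDiffRiemannianBundle (𝓡 3) ∞ (EuclideanSpace ℝ (Fin 3))
  (fun x : M => TangentSpace (𝓡 3) x)]

instance isContMDiffRiemannianBundle_one :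
    IsContMDiffRiemannianBundle (𝓡 3) 1 (EuclideanSpace ℝ (Fin 3))
      (fun x : M => TangentSpace (𝓡 3) x) :=
  IsContMDiffRiemannianBundle.of_le (n := ∞) (by simp)

theorem IsLeviCivita.mvfderiv_inner (h : IsLeviCivita nabla) {V W : VField M}
    (hV : VDiffAt V x) (hW : VDiffAt W x) (v : TangentSpace (𝓡 3) x) :
    mvfderiv (𝓡 3) (fun y => (inner ℝ (V y) (W y) : ℝ)) x v =
      inner ℝ (nabla V x v) (W x) + inner ℝ (V x) (nabla W x v) := by
  -- Metric compatibility is applied to a vector field, so the single vector `v` is first extended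
  -- to one.
  have H := h.metric.mvfderiv_inner_eq (FiberBundle.extend (EuclideanSpace ℝ (Fin 3)) v) hV hW
  simpa only [FiberBundle.extend_apply_self] using H

theorem IsLeviCivita.mlieBracket_eq (h : IsLeviCivita nabla) {V W : VField M}
    (hV : VDiffAt V x) (hW : VDiffAt W x) :
    VectorField.mlieBracket (𝓡 3) V W x = nabla W x (V x) - nabla V x (W x) :=
  ((nabla.torsion_eq_zero_iff.1 h.torsion_eq_zero) hV hW).symm

theorem IsLeviCivita.connForm_antisymm (h : IsLeviCivita nabla) (he : IsOrthonormalFrameOn e U)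
    (hU : IsOpen U) (hx : x ∈ U) (i j : Fin 3) (v : TangentSpace (𝓡 3) x) :
    connForm nabla e i j x v = -connForm nabla e j i x v := by
  have h1 := h.mvfderiv_inner (he.smoothAt hU hx i).vDiffAt (he.smoothAt hU hx j).vDiffAt v
  have h2 : (fun y => (inner ℝ (e i y) (e j y) : ℝ)) =ᶠ[nhds x] fun _ => if i = j then 1 else 0 :=
    Filter.eventuallyEq_of_mem (hU.mem_nhds hx) fun y hy => he.inner_eq hy i j
  have h3 : mvfderiv (𝓡 3) (fun y => (inner ℝ (e i y) (e j y) : ℝ)) x v = 0 := by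
    have : mvfderiv (𝓡 3) (fun y => (inner ℝ (e i y) (e j y) : ℝ)) x v =
      mvfderiv (𝓡 3) (fun _ : M => (if i = j then 1 else 0 : ℝ)) x v := by
      simp only [mvfderiv, h2.mfderiv_eq]; rfl
    rw [this, mvfderiv_const]; rfl
  rw [h3] at h1
  simp only [connForm, ContinuousLinearMap.comp_apply, innerSL_apply_apply]
  rw [real_inner_comm]
  linarith

theorem IsLeviCivita.gam_antisymm (h : IsLeviCivita nabla) (he : IsOrthonormalFrameOn e U)
    (hU : IsOpen U) (hx : x ∈ U) (k i j : Fin 3) :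
    gam nabla e k i j x = -gam nabla e k j i x := by
  simpa only [connForm_apply] using h.connForm_antisymm he hU hx i j (e k x)

theorem IsLeviCivita.gam_self (h : IsLeviCivita nabla) (he : IsOrthonormalFrameOn e U)
    (hU : IsOpen U) (hx : x ∈ U) (k i : Fin 3) : gam nabla e k i i x = 0 := by
  have := h.gam_antisymm he hU hx k i i
  linarith

theorem IsLeviCivita.structFun_eq (h : IsLeviCivita nabla) (he : IsOrthonormalFrameOn e U)
    (hU : IsOpen U) (hx : x ∈ U) (k l p : Fin 3) :
    structFun e k l p x = gam nabla e k l p x - gam nabla e l k p x := by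
  rw [structFun, h.mlieBracket_eq (he.smoothAt hU hx k).vDiffAt (he.smoothAt hU hx l).vDiffAt,
    inner_sub_left]
  rfl

/-- The Koszul formula in an orthonormal frame. -/
theorem IsLeviCivita.gam_eq_structFun (h : IsLeviCivita nabla) (he : IsOrthonormalFrameOn e U)
    (hU : IsOpen U) (hx : x ∈ U) (k i j : Fin 3) :
    gam nabla e k i j x =
      (structFun e k i j x - structFun e i j k x + structFun e j k i x) / 2 := by
  simp only [h.structFun_eq he hU hx]
  have h1 := h.gam_antisymm he hU hx i j k
  have h2 := h.gam_antisymm he hU hx j k i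
  have h3 := h.gam_antisymm he hU hx k i j
  linear_combination (h1 - h2 + h3) / 2

theorem IsOrthonormalFrameOn.structFun_smooth (he : IsOrthonormalFrameOn e U) (hU : IsOpen U)
    (k l p : Fin 3) : ContMDiffOn (𝓡 3) 𝓘(ℝ, ℝ) ∞ (structFun e k l p) U := fun _ hx =>
  (ContMDiffAt.inner_bundle (he.mlieBracket_smoothAt hU hx k l)
    (he.smoothAt hU hx p)).contMDiffWithinAt

/-- Regularity of `nabla` is deduced, not assumed: the Koszul formula expresses the coefficients
through brackets of frame fields, which are smooth. -/
theorem IsLeviCivita.gam_smooth (h : IsLeviCivita nabla) (he : IsOrthonormalFrameOn e U)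
    (hU : IsOpen U) (k i j : Fin 3) : ContMDiffOn (𝓡 3) 𝓘(ℝ, ℝ) ∞ (gam nabla e k i j) U := by
  refine ContMDiffOn.congr (f := fun x => (structFun e k i j x - structFun e i j k x
    + structFun e j k i x) * 2⁻¹) ?_ fun x hx => ?_
  · exact (((he.structFun_smooth hU k i j).sub (he.structFun_smooth hU i j k)).add
      (he.structFun_smooth hU j k i)).mul contMDiffOn_const
  · rw [h.gam_eq_structFun he hU hx, div_eq_mul_inv]

theorem IsLeviCivita.gam_mDiffAt (h : IsLeviCivita nabla) (he : IsOrthonormalFrameOn e U)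
    (hU : IsOpen U) (hx : x ∈ U) (k i j : Fin 3) :
    MDifferentiableAt (𝓡 3) 𝓘(ℝ, ℝ) (gam nabla e k i j) x :=
  ((h.gam_smooth he hU k i j).contMDiffAt (hU.mem_nhds hx)).mdifferentiableAt (by simp)

theorem IsLeviCivita.nabla_vDiffAt (h : IsLeviCivita nabla) (he : IsOrthonormalFrameOn e U)
    (hU : IsOpen U) (hx : x ∈ U) (k i : Fin 3) :
    VDiffAt (fun y => nabla (e i) y (e k y)) x :=
  (VDiffAt.sum_smul (fun p => h.gam_mDiffAt he hU hx k i p)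
    fun p => (he.smoothAt hU hx p).vDiffAt).congr hU hx fun _ hy => he.nabla_eq hy k i

/-- The inner derivative is expanded in the frame on all of `U`, and the Leibniz rule is then
applied to its coefficients. -/
theorem IsLeviCivita.inner_nabla_nabla (h : IsLeviCivita nabla) (he : IsOrthonormalFrameOn e U)
    (hU : IsOpen U) (hx : x ∈ U) (k l j i : Fin 3) :
    (inner ℝ (nabla (fun y => nabla (e j) y (e l y)) x (e k x)) (e i x) : ℝ) =
      D e k (gam nabla e l j i) x + ∑ p, gam nabla e l j p x * gam nabla e k p i x := by
  rw [nabla_congr (h.nabla_vDiffAt he hU hx l j)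
    (VDiffAt.sum_smul (fun p => h.gam_mDiffAt he hU hx l j p)
      fun p => (he.smoothAt hU hx p).vDiffAt) hU hx fun y hy => he.nabla_eq hy l j,
    nabla_sum_smul (fun p => h.gam_mDiffAt he hU hx l j p)
      fun p => (he.smoothAt hU hx p).vDiffAt]
  simp only [sum_inner, inner_add_left, inner_smul_left, he.inner_eq hx, Finset.sum_add_distrib]
  simp [D, gam, add_comm]

theorem IsLeviCivita.inner_nabla_mlieBracket (h : IsLeviCivita nabla)
    (he : IsOrthonormalFrameOn e U) (hU : IsOpen U) (hx : x ∈ U) (k l j i : Fin 3) :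
    (inner ℝ (nabla (e j) x (VectorField.mlieBracket (𝓡 3) (e k) (e l) x)) (e i x) : ℝ) =
      ∑ p, (gam nabla e k l p x - gam nabla e l k p x) * gam nabla e p j i x := by
  rw [he.sum_inner_smul hx (VectorField.mlieBracket (𝓡 3) (e k) (e l) x)]
  simp only [map_sum, map_smul, sum_inner, inner_smul_left, ← h.structFun_eq he hU hx]
  rfl

theorem IsLeviCivita.riem_eq (h : IsLeviCivita nabla) (he : IsOrthonormalFrameOn e U)
    (hU : IsOpen U) (hx : x ∈ U) (i j k l : Fin 3) :
    riem nabla e i j k l x =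
      D e k (gam nabla e l j i) x - D e l (gam nabla e k j i) x
      + ∑ p, (gam nabla e l j p x * gam nabla e k p i x - gam nabla e k j p x * gam nabla e l p i x)
      - ∑ p, (gam nabla e k l p x - gam nabla e l k p x) * gam nabla e p j i x := by
  rw [riem, curvOp, inner_sub_left, inner_sub_left, h.inner_nabla_nabla he hU hx,
    h.inner_nabla_nabla he hU hx, h.inner_nabla_mlieBracket he hU hx, Finset.sum_sub_distrib]
  ring

end Frame

/-! ### Structure equations, curvature symmetries and the nine relations. -/

section Structure

variable {M : Type*} [TopologicalSpace M] [ChartedSpace (EuclideanSpace ℝ (Fin 3)) M]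
  [IsManifold (𝓡 3) ∞ M] [RiemannianBundle (fun x : M => TangentSpace (𝓡 3) x)]
  [IsContMDiffRiemannianBundle (𝓡 3) ∞ (EuclideanSpace ℝ (Fin 3))
    (fun x : M => TangentSpace (𝓡 3) x)]
  {e : Fin 3 → VField M} {U : Set M} {x : M}
  {nabla : CovariantDerivative (𝓡 3) (EuclideanSpace ℝ (Fin 3))
    (fun x : M => TangentSpace (𝓡 3) x)}

/-- The coframe takes constant values on the frame, so only the bracket term of the exterior
derivative survives; vanishing torsion expresses it through the connection forms. -/
theorem IsLeviCivita.extD_coframe (h : IsLeviCivita nabla) (he : IsOrthonormalFrameOn e U)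
    (hU : IsOpen U) (hx : x ∈ U) (i k l : Fin 3) :
    extD (coframe e i) (e k) (e l) x =
      ∑ p, wedge (coframe e p) (connForm nabla e p i) (e k) (e l) x := by
  rw [extD_of_eqOn hU hx (fun y hy => he.coframe_frame hy i l)
    (fun y hy => he.coframe_frame hy i k), D_const, D_const, coframe_apply, real_inner_comm]
  have h1 := h.structFun_eq he hU hx k l i
  rw [structFun] at h1
  rw [h1]
  simp [wedge, he.coframe_frame hx, connForm_apply, Finset.sum_sub_distrib]

/-- This is `riem_eq` term by term. The indices come out as `j i` because `riem` applies the
curvature operator to the field of its second index. -/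
theorem IsLeviCivita.extD_connForm (h : IsLeviCivita nabla) (he : IsOrthonormalFrameOn e U)
    (hU : IsOpen U) (hx : x ∈ U) (i j k l : Fin 3) :
    extD (connForm nabla e i j) (e k) (e l) x
      - ∑ p, wedge (connForm nabla e i p) (connForm nabla e p j) (e k) (e l) x =
      riem nabla e j i k l x := by
  rw [extD_of_eqOn hU hx (fun y _ => connForm_apply i j l) (fun y _ => connForm_apply i j k),
    h.riem_eq he hU hx, ← h.inner_nabla_mlieBracket he hU hx, real_inner_comm]
  simp only [wedge, connForm_apply, Finset.sum_sub_distrib]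
  simp only [connForm, ContinuousLinearMap.comp_apply, innerSL_apply_apply]
  rw [real_inner_comm]
  ring

theorem IsLeviCivita.D_gam_antisymm (h : IsLeviCivita nabla) (he : IsOrthonormalFrameOn e U)
    (hU : IsOpen U) (hx : x ∈ U) (q k i j : Fin 3) :
    D e q (gam nabla e k i j) x = -D e q (gam nabla e k j i) x := by
  rw [← D_neg]
  exact D_congr_of_eqOn hU hx fun y hy => h.gam_antisymm he hU hy k i j

theorem IsLeviCivita.riem_antisymm_left (h : IsLeviCivita nabla) (he : IsOrthonormalFrameOn e U)
    (hU : IsOpen U) (hx : x ∈ U) (i j k l : Fin 3) :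
    riem nabla e i j k l x = -riem nabla e j i k l x := by
  rw [h.riem_eq he hU hx, h.riem_eq he hU hx, h.D_gam_antisymm he hU hx k l j i,
    h.D_gam_antisymm he hU hx l k j i]
  have h1 : ∀ p, gam nabla e p j i x = -gam nabla e p i j x := fun p =>
    h.gam_antisymm he hU hx p j i
  have h2 : ∀ p, gam nabla e l j p x * gam nabla e k p i x - gam nabla e k j p x *
      gam nabla e l p i x = -(gam nabla e l i p x * gam nabla e k p j x - gam nabla e k i p x *
      gam nabla e l p j x) := fun p => by
    rw [h.gam_antisymm he hU hx l j p, h.gam_antisymm he hU hx k p i,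
      h.gam_antisymm he hU hx k j p, h.gam_antisymm he hU hx l p i]
    ring
  simp only [h1, h2, mul_neg, Finset.sum_neg_distrib]
  ring

/-- The first Bianchi identity. -/
theorem IsLeviCivita.riem_cyclic (h : IsLeviCivita nabla) (he : IsOrthonormalFrameOn e U)
    (hU : IsOpen U) (hx : x ∈ U) (i j k l : Fin 3) :
    riem nabla e i j k l x + riem nabla e i k l j x + riem nabla e i l j k x = 0 := by
  have hV : ∀ i, VDiffAt (e i) x := fun i => (he.smoothAt hU hx i).vDiffAt
  have hN := h.nabla_vDiffAt he hU hx
  have hB : ∀ k l, VSmoothAt (VectorField.mlieBracket (𝓡 3) (e k) (e l)) x := fun k l =>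
    he.mlieBracket_smoothAt hU hx k l
  -- Vanishing torsion is used twice: the first two terms combine to ∇_k [e_l, e_j], and subtracting
  -- ∇_{[e_l, e_j]} e_k leaves a double bracket. Summed cyclically, the left sides give the
  -- curvature sum and the right sides the Jacobi identity.
  have key : ∀ k l j, nabla (fun y => nabla (e j) y (e l y)) x (e k x)
      - nabla (fun y => nabla (e l) y (e j y)) x (e k x)
      - nabla (e k) x (VectorField.mlieBracket (𝓡 3) (e l) (e j) x) =
      VectorField.mlieBracket (𝓡 3) (e k) (VectorField.mlieBracket (𝓡 3) (e l) (e j)) x := by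
    intro k l j
    rw [h.mlieBracket_eq (hV k) (hB l j).vDiffAt]
    have h1 : nabla (fun y => nabla (e j) y (e l y)) x (e k x) =
        nabla (fun y => VectorField.mlieBracket (𝓡 3) (e l) (e j) y + nabla (e l) y (e j y)) x
          (e k x) := by
      rw [nabla_congr (hN l j) ((hB l j).vDiffAt.add (hN j l)) hU hx fun y hy => ?_]
      rw [h.mlieBracket_eq (he.smoothAt hU hy l).vDiffAt (he.smoothAt hU hy j).vDiffAt]
      abel
    rw [h1, nabla_add (hB l j).vDiffAt (hN j l)]
    simp only [add_apply]
    abel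
  have : IsManifold (𝓡 3) (minSmoothness ℝ 3) M := by
    rw [minSmoothness_of_isRCLikeNormedField]; infer_instance
  have hS : ∀ i, ContMDiffAt (𝓡 3) ((𝓡 3).prod 𝓘(ℝ, EuclideanSpace ℝ (Fin 3)))
      (minSmoothness ℝ 2) (fun x => Bundle.TotalSpace.mk' (EuclideanSpace ℝ (Fin 3)) x (e i x)) x :=
    fun i => (he.smoothAt hU hx i).of_le (by
      rw [minSmoothness_of_isRCLikeNormedField]; exact WithTop.coe_le_coe.2 le_top)
  have jac := VectorField.leibniz_identity_mlieBracket_apply (hS k) (hS l) (hS j)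
  -- The Leibniz form of the Jacobi identity is brought to cyclic double brackets; the inner sign is
  -- written as the scalar -1 to be pulled out by linearity.
  rw [VectorField.mlieBracket_swap_apply (V := VectorField.mlieBracket (𝓡 3) (e k) (e l)),
    VectorField.mlieBracket_swap (V := e k) (W := e j),
    show -VectorField.mlieBracket (𝓡 3) (e j) (e k) = (-1 : ℝ) • _ from (neg_one_smul ℝ _).symm,
    VectorField.mlieBracket_const_smul_right (hB j k).vDiffAt] at jac
  rw [riem, riem, riem, ← inner_add_left, ← inner_add_left]
  have hz : curvOp nabla (e k) (e l) (e j) x + curvOp nabla (e l) (e j) (e k) x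
      + curvOp nabla (e j) (e k) (e l) x = 0 := by
    have e1 := key k l j
    have e2 := key l j k
    have e3 := key j k l
    simp only [curvOp]
    rw [← e1, ← e2, ← e3] at jac
    rw [← sub_eq_zero] at jac
    rw [← jac]
    module
  rw [hz, inner_zero_left]

/-- A formal consequence of the two antisymmetries and the four cyclic identities obtained by
rotating `i j k l`. -/
theorem IsLeviCivita.riem_pair_symm (h : IsLeviCivita nabla) (he : IsOrthonormalFrameOn e U)
    (hU : IsOpen U) (hx : x ∈ U) (i j k l : Fin 3) :
    riem nabla e i j k l x = riem nabla e k l i j x := by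
  have A := h.riem_antisymm_left he hU hx
  have B := fun i j k l => riem_antisymm_right (nabla := nabla) (e := e) (x := x) i j k l
  have C := h.riem_cyclic he hU hx
  have c1 := C i j k l
  have c2 := C j k l i
  have c3 := C k l i j
  have c4 := C l i j k
  linarith [A i j k l, A i k l j, A i l j k, A j k l i, A j l i k, A j i k l, A k l i j, A k i j l,
    A k j l i, A l i j k, A l j k i, A l k i j, B i j k l, B i k l j, B i l j k, B j k l i,
    B j l i k, B j i k l, B k l i j, B k i j l, B k j l i, B l i j k, B l j k i, B l k i j]

theorem IsLeviCivita.modes_s (h : IsLeviCivita nabla) (he : IsOrthonormalFrameOn e U)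
    (hU : IsOpen U) (hx : x ∈ U) :
    (modes nabla e).s x = gam nabla e 1 0 1 x + gam nabla e 2 0 2 x := by
  have h1 : (modes nabla e).s x = ∑ p, gam nabla e p 0 p x := he.trace_eq hx _
  rw [h1, Fin.sum_univ_three, h.gam_self he hU hx, zero_add]

theorem IsLeviCivita.modes_d1 (h : IsLeviCivita nabla) (he : IsOrthonormalFrameOn e U)
    (hU : IsOpen U) (hx : x ∈ U) :
    (modes nabla e).d1 x = (gam nabla e 1 0 1 x - gam nabla e 2 0 2 x) / 2 := by
  have h1 : (modes nabla e).d1 x = (gam nabla e 1 0 1 x + gam nabla e 1 0 1 x) / 2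
    - (modes nabla e).s x / 2 * inner ℝ (e 1 x) (e 1 x) := rfl
  rw [h1, he.inner_eq hx, h.modes_s he hU hx]
  simp; ring

theorem IsLeviCivita.aux_k32 (h : IsLeviCivita nabla) (he : IsOrthonormalFrameOn e U)
    (hU : IsOpen U) (hx : x ∈ U) : (aux nabla e).k32 x = -gam nabla e 2 1 2 x :=
  h.gam_antisymm he hU hx 2 2 1

theorem IsLeviCivita.modes_smoothOn (h : IsLeviCivita nabla) (he : IsOrthonormalFrameOn e U)
    (hU : IsOpen U) : (modes nabla e).SmoothOn U := by
  have G := h.gam_smooth he hU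
  have half : ∀ {f : M → ℝ}, ContMDiffOn (𝓡 3) 𝓘(ℝ, ℝ) ∞ f U →
      ContMDiffOn (𝓡 3) 𝓘(ℝ, ℝ) ∞ (fun x => f x / 2) U := fun hf => by
    simp only [div_eq_mul_inv]
    exact hf.mul contMDiffOn_const
  refine ⟨?_, (G 1 0 2).sub (G 2 0 1), ?_, ?_, ?_, ?_⟩
  · exact ((G 1 0 1).add (G 2 0 2)).congr fun x hx => h.modes_s he hU hx
  · exact (contMDiffOn_const (c := (-1 : ℝ)).mul (G 0 0 1)).congr fun x hx => by
      rw [modes_bp]; simp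
  · exact (contMDiffOn_const (c := (-1 : ℝ)).mul (G 0 0 2)).congr fun x hx => by
      rw [modes_bx]; simp
  · exact (half ((G 1 0 1).sub (G 2 0 2))).congr fun x hx => h.modes_d1 he hU hx
  · exact (half ((G 1 0 2).add (G 2 0 1))).congr fun x hx => he.modes_d2 hx

theorem IsLeviCivita.connForm_eq (h : IsLeviCivita nabla) (he : IsOrthonormalFrameOn e U)
    (hU : IsOpen U) (hx : x ∈ U) (v : TangentSpace (𝓡 3) x) :
    connForm nabla e 0 1 x v =
        -(modes nabla e).bp x * coframe e 0 x v
        + ((modes nabla e).s x / 2 + (modes nabla e).d1 x) * coframe e 1 x v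
        + (-((modes nabla e).t x / 2) + (modes nabla e).d2 x) * coframe e 2 x v ∧
    connForm nabla e 0 2 x v =
        -(modes nabla e).bx x * coframe e 0 x v
        + ((modes nabla e).t x / 2 + (modes nabla e).d2 x) * coframe e 1 x v
        + ((modes nabla e).s x / 2 - (modes nabla e).d1 x) * coframe e 2 x v ∧
    connForm nabla e 1 2 x v =
        (aux nabla e).w1 x * coframe e 0 x v + (aux nabla e).k21 x * coframe e 1 x v
        - (aux nabla e).k32 x * coframe e 2 x v := by
  simp only [he.eq_sum_coframe hx (connForm nabla e _ _ x) v, Fin.sum_univ_three, connForm_apply,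
    modes_bp, modes_bx, modes_t, h.modes_s he hU hx, h.modes_d1 he hU hx, he.modes_d2 hx,
    aux_w1, aux_k21, h.aux_k32 he hU hx]
  refine ⟨?_, ?_, ?_⟩ <;> ring

/-- The coefficient dictionary is established on all of `U` because its entries are also
differentiated; the rest is substitution into `riem_eq`. -/
theorem IsLeviCivita.nineRelations (h : IsLeviCivita nabla) (he : IsOrthonormalFrameOn e U)
    (hU : IsOpen U) (hx : x ∈ U) :
    NineRelations e (riem nabla e) (modes nabla e) (aux nabla e) x := by
  have g00 : ∀ y ∈ U, gam nabla e 0 0 1 y = -(modes nabla e).bp y := fun y _ => by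
    rw [modes_bp, neg_neg]
  have g01 : ∀ y ∈ U, gam nabla e 0 0 2 y = -(modes nabla e).bx y := fun y _ => by
    rw [modes_bx, neg_neg]
  have g10 : ∀ y ∈ U, gam nabla e 1 0 1 y = (modes nabla e).s y / 2 + (modes nabla e).d1 y :=
    fun y hy => by rw [h.modes_s he hU hy, h.modes_d1 he hU hy]; ring
  have g20 : ∀ y ∈ U, gam nabla e 2 0 1 y = -((modes nabla e).t y / 2) + (modes nabla e).d2 y :=
    fun y hy => by rw [modes_t, he.modes_d2 hy]; ring
  have g11 : ∀ y ∈ U, gam nabla e 1 0 2 y = (modes nabla e).t y / 2 + (modes nabla e).d2 y :=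
    fun y hy => by rw [modes_t, he.modes_d2 hy]; ring
  have g21 : ∀ y ∈ U, gam nabla e 2 0 2 y = (modes nabla e).s y / 2 - (modes nabla e).d1 y :=
    fun y hy => by rw [h.modes_s he hU hy, h.modes_d1 he hU hy]; ring
  have g02 : ∀ y ∈ U, gam nabla e 0 1 2 y = (aux nabla e).w1 y := fun y _ => rfl
  have g12 : ∀ y ∈ U, gam nabla e 1 1 2 y = (aux nabla e).k21 y := fun y _ => rfl
  have g22 : ∀ y ∈ U, gam nabla e 2 1 2 y = -(aux nabla e).k32 y := fun y hy => by
    rw [h.aux_k32 he hU hy, neg_neg]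
  have S := h.gam_self he hU hx
  -- Skewness brings every coefficient and derivative to the index order i < j covered by the
  -- dictionary.
  have a1 : ∀ k, gam nabla e k 1 0 x = -gam nabla e k 0 1 x := fun k =>
    h.gam_antisymm he hU hx k 1 0
  have a2 : ∀ k, gam nabla e k 2 0 x = -gam nabla e k 0 2 x := fun k =>
    h.gam_antisymm he hU hx k 2 0
  have a3 : ∀ k, gam nabla e k 2 1 x = -gam nabla e k 1 2 x := fun k =>
    h.gam_antisymm he hU hx k 2 1
  have d1 : ∀ q k, D e q (gam nabla e k 1 0) x = -D e q (gam nabla e k 0 1) x := fun q k =>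
    h.D_gam_antisymm he hU hx q k 1 0
  have d2 : ∀ q k, D e q (gam nabla e k 2 0) x = -D e q (gam nabla e k 0 2) x := fun q k =>
    h.D_gam_antisymm he hU hx q k 2 0
  have d3 : ∀ q k, D e q (gam nabla e k 2 1) x = -D e q (gam nabla e k 1 2) x := fun q k =>
    h.D_gam_antisymm he hU hx q k 2 1
  have E00 : ∀ q, D e q (gam nabla e 0 0 1) x = -D e q (modes nabla e).bp x := fun q =>
    (D_congr_of_eqOn hU hx g00).trans D_neg
  have E01 : ∀ q, D e q (gam nabla e 0 0 2) x = -D e q (modes nabla e).bx x := fun q =>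
    (D_congr_of_eqOn hU hx g01).trans D_neg
  have E22 : ∀ q, D e q (gam nabla e 2 1 2) x = -D e q (aux nabla e).k32 x := fun q =>
    (D_congr_of_eqOn hU hx g22).trans D_neg
  have E10 : ∀ q, D e q (gam nabla e 1 0 1) x = _ := fun q => D_congr_of_eqOn hU hx g10
  have E20 : ∀ q, D e q (gam nabla e 2 0 1) x = _ := fun q => D_congr_of_eqOn hU hx g20
  have E11 : ∀ q, D e q (gam nabla e 1 0 2) x = _ := fun q => D_congr_of_eqOn hU hx g11
  have E21 : ∀ q, D e q (gam nabla e 2 0 2) x = _ := fun q => D_congr_of_eqOn hU hx g21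
  have E02 : ∀ q, D e q (gam nabla e 0 1 2) x = D e q (aux nabla e).w1 x := fun q => rfl
  have E12 : ∀ q, D e q (gam nabla e 1 1 2) x = D e q (aux nabla e).k21 x := fun q => rfl
  have hD : (modes nabla e).Dsq x = (modes nabla e).d1 x ^ 2 + (modes nabla e).d2 x ^ 2 := rfl
  constructor <;>
  · rw [h.riem_eq he hU hx]
    simp only [Fin.sum_univ_three, S, a1, a2, a3, d1, d2, d3, E00, E01, E22, E10, E20, E11, E21,
      E02, E12, g00 x hx, g01 x hx, g10 x hx, g20 x hx, g11 x hx, g21 x hx, g02 x hx, g12 x hx,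
      g22 x hx, hD]
    ring

end Structure

/-! ### Smoothness of composition operators on spaces of continuous curves. -/

section Nemytskii

open Set Filter Topology

universe u

variable {K : Type*} [TopologicalSpace K] [CompactSpace K]

variable {E W Z : Type u} [NormedAddCommGroup E] [NormedSpace ℝ E] [NormedAddCommGroup W]
  [NormedSpace ℝ W] [NormedAddCommGroup Z] [NormedSpace ℝ Z]

/-- The bounded bilinear map `C(K, Z) × C(K, E) → C(K, W)` induced pointwise by a bounded bilinear
map `Z × E → W`. -/
def ContinuousMap.bilin (K : Type*) [TopologicalSpace K] [CompactSpace K]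
    (B : Z →L[ℝ] E →L[ℝ] W) : C(K, Z) →L[ℝ] C(K, E) →L[ℝ] C(K, W) :=
  LinearMap.mkContinuous₂
    (LinearMap.mk₂ ℝ (fun (A : C(K, Z)) (η : C(K, E)) =>
        (⟨fun τ => B (A τ) (η τ), by fun_prop⟩ : C(K, W)))
      (fun _ _ _ => by ext; simp) (fun _ _ _ => by ext; simp)
      (fun _ _ _ => by ext; simp) (fun _ _ _ => by ext; simp)) ‖B‖
    (fun A η => by
      refine (ContinuousMap.norm_le _ (by positivity)).2 fun τ => ?_
      refine (B.le_opNorm₂ _ _).trans ?_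
      gcongr
      exacts [A.norm_coe_le_norm τ, η.norm_coe_le_norm τ])

theorem ContinuousMap.bilin_apply (B : Z →L[ℝ] E →L[ℝ] W) (A : C(K, Z)) (η : C(K, E)) (τ : K) :
    ContinuousMap.bilin K B A η τ = B (A τ) (η τ) := rfl

/-- The mean value inequality is applied at each `τ`, with an error bound uniform in `τ`. Uniformity
comes from continuity of η ↦ F' ∘ (γ + η) in the supremum norm, which rests on compactness of `K`.
-/
theorem ContinuousMap.hasFDerivAt_comp {F : C(E, W)} {F' : C(E, Z)} (B : Z →L[ℝ] E →L[ℝ] W)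
    (hF : ∀ x, HasFDerivAt F (B (F' x)) x) (γ : C(K, E)) :
    HasFDerivAt (fun γ : C(K, E) => F.comp γ) (ContinuousMap.bilin K B (F'.comp γ)) γ := by
  rw [hasFDerivAt_iff_isLittleO_nhds_zero, Asymptotics.isLittleO_iff]
  intro c hc
  have hcont : Continuous fun η : C(K, E) => F'.comp (γ + η) :=
    (ContinuousMap.continuous_postcomp F').comp (continuous_const.add continuous_id)
  have hB : 0 < ‖B‖ + 1 := by positivity
  obtain ⟨δ, hδ, hδc⟩ := Metric.continuousAt_iff.1 (hcont.continuousAt (x := 0)) (c / (‖B‖ + 1))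
    (by positivity)
  filter_upwards [Metric.ball_mem_nhds (0 : C(K, E)) hδ] with η hη
  refine (ContinuousMap.norm_le _ (by positivity)).2 fun τ => ?_
  -- A point of the segment is the value at `τ` of the curve γ + θ • η, and ‖θ • η‖ ≤ ‖η‖ < δ.
  have hbound : ∀ z ∈ segment ℝ (γ τ) (γ τ + η τ), ‖B (F' z) - B (F' (γ τ))‖ ≤ c := by
    intro z hz
    rw [segment_eq_image'] at hz
    obtain ⟨θ, hθ, rfl⟩ := hz
    have h1 : dist (θ • η) 0 < δ := by
      rw [dist_zero_right, norm_smul, Real.norm_of_nonneg hθ.1]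
      rw [Metric.mem_ball, dist_zero_right] at hη
      exact (mul_le_of_le_one_left (norm_nonneg _) hθ.2).trans_lt hη
    have h2 := (hδc h1).le
    rw [dist_eq_norm] at h2
    have h3 := (ContinuousMap.norm_coe_le_norm _ τ).trans h2
    rw [← map_sub]
    refine (B.le_opNorm _).trans ?_
    have h4 : ‖F' (γ τ + θ • (γ τ + η τ - γ τ)) - F' (γ τ)‖ ≤ c / (‖B‖ + 1) := by
      simpa using h3
    rw [le_div_iff₀ hB] at h4
    nlinarith [norm_nonneg (F' (γ τ + θ • (γ τ + η τ - γ τ)) - F' (γ τ))]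
  have h := (convex_segment (γ τ) (γ τ + η τ)).norm_image_sub_le_of_norm_hasFDerivWithin_le'
    (fun z _ => (hF z).hasFDerivWithinAt) hbound (left_mem_segment ℝ _ _)
    (right_mem_segment ℝ _ _)
  simp only [add_sub_cancel_left] at h
  refine le_trans (le_of_eq ?_) (h.trans (mul_le_mul_of_nonneg_left (η.norm_coe_le_norm τ) hc.le))
  simp [ContinuousMap.bilin_apply]

-- Induction on `n`: the derivative of composition with `F` is a fixed bounded linear map applied to
-- composition with `fderiv ℝ F`. The target changes from `W` to `E →L[ℝ] W`, so `W` is quantified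
-- inside the induction and shares its universe with `E`.
set_option synthInstance.maxHeartbeats 400000 in
theorem ContinuousMap.contDiff_comp_nat (n : ℕ) : ∀ {W : Type u} [NormedAddCommGroup W]
    [NormedSpace ℝ W] {F : C(E, W)}, ContDiff ℝ n F →
      ContDiff ℝ n (fun γ : C(K, E) => F.comp γ) := by
  induction n with
  | zero =>
    intro W _ _ F _
    rw [Nat.cast_zero, contDiff_zero]
    exact ContinuousMap.continuous_postcomp F
  | succ n ih =>
    intro W _ _ F hF
    have hF1 : ContDiff ℝ 1 F := hF.of_le (by norm_cast; omega)
    have hF' : ContDiff ℝ n (fderiv ℝ F) := hF.fderiv_right (by norm_cast)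
    let F' : C(E, E →L[ℝ] W) := ⟨fderiv ℝ F, hF'.continuous⟩
    have hd : ∀ γ : C(K, E), HasFDerivAt (fun γ : C(K, E) => F.comp γ)
        (ContinuousMap.bilin K (ContinuousLinearMap.id ℝ (E →L[ℝ] W)) (F'.comp γ)) γ :=
      ContinuousMap.hasFDerivAt_comp (F' := F') _ fun x =>
        (hF1.differentiable (by simp) x).hasFDerivAt
    push_cast
    refine contDiff_succ_iff_hasFDerivAt.2 ⟨_, ?_, hd⟩
    exact (ContinuousMap.bilin K (ContinuousLinearMap.id ℝ (E →L[ℝ] W))).contDiff.comp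
      (ih (F := F') hF')

/-- Composition with a smooth map is a smooth operator on spaces of continuous functions. -/
theorem ContinuousMap.contDiff_comp {F : C(E, W)} (hF : ContDiff ℝ ∞ F) :
    ContDiff ℝ ∞ (fun γ : C(K, E) => F.comp γ) :=
  contDiff_infty.2 fun n => ContinuousMap.contDiff_comp_nat n (contDiff_infty.1 hF n)

end Nemytskii

/-! ### An inverse function theorem with smoothness on the whole target. -/

section InverseFunction

variable {X Y : Type*} [NormedAddCommGroup X] [NormedSpace ℝ X] [CompleteSpace X]
  [NormedAddCommGroup Y] [NormedSpace ℝ Y]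

/-- The smooth inverse function theorem, with an inverse that is smooth on an open set. -/
theorem exists_openPartialHomeomorph_contDiffOn_symm {f : X → Y} {S : Set X} {a : X}
    (hS : IsOpen S) (ha : a ∈ S) (hf : ContDiffOn ℝ ∞ f S) (f' : X ≃L[ℝ] Y)
    (hf' : HasFDerivAt f (f' : X →L[ℝ] Y) a) :
    ∃ P : OpenPartialHomeomorph X Y, (P : X → Y) = f ∧ a ∈ P.source ∧ P.source ⊆ S ∧
      ContDiffOn ℝ ∞ P.symm P.target := by
  have hfa : ContDiffAt ℝ ∞ f a := hf.contDiffAt (hS.mem_nhds ha)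
  let P₀ := hfa.toOpenPartialHomeomorph f hf' (by simp)
  have hP₀ : (P₀ : X → Y) = f := hfa.toOpenPartialHomeomorph_coe hf' (by simp)
  -- Invertibility of the derivative is an open condition; restricting to it makes the inverse
  -- smooth at every point of the target.
  let T : Set X := S ∩ fderiv ℝ f ⁻¹' Set.range ((↑) : (X ≃L[ℝ] Y) → X →L[ℝ] Y)
  have hT : IsOpen T := (hf.continuousOn_fderiv_of_isOpen hS (by simp)).isOpen_inter_preimage hS
    ContinuousLinearEquiv.isOpen
  have haT : a ∈ T := ⟨ha, f', hf'.fderiv.symm⟩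
  refine ⟨P₀.restrOpen T hT, hP₀, ⟨hfa.mem_toOpenPartialHomeomorph_source hf' (by simp), haT⟩,
    fun x hx => hx.2.1, ?_⟩
  intro y hy
  have hx := (P₀.restrOpen T hT).map_target hy
  obtain ⟨-, hxS, g, hg⟩ := hx
  have hd := hf.contDiffAt (hS.mem_nhds hxS)
  refine (OpenPartialHomeomorph.contDiffAt_symm (f₀' := g) _ hy ?_ ?_).contDiffWithinAt
  · rw [hg]
    exact (hd.differentiableAt (by simp)).hasFDerivAt
  · exact hd

end InverseFunction

/-! ### Local flows, smooth jointly in time and initial value. -/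

section Flow

open Set Filter Topology

universe u

variable {E : Type u} [NormedAddCommGroup E] 

theorem ContinuousMap.continuous_IccExtend (g : C(Icc (-1 : ℝ) 1, E)) :
    Continuous (IccExtend (by norm_num : (-1 : ℝ) ≤ 1) g) :=
  g.continuous.Icc_extend'

theorem ContinuousMap.norm_IccExtend_le (g : C(Icc (-1 : ℝ) 1, E)) (s : ℝ) :
    ‖IccExtend (by norm_num : (-1 : ℝ) ≤ 1) g s‖ ≤ ‖g‖ :=
  g.norm_coe_le_norm _

variable [NormedSpace ℝ E]

/-- The operator taking a continuous function on `[-1, 1]` to its primitive vanishing at `0`. -/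
def ContinuousMap.primitive (E : Type u) [NormedAddCommGroup E] [NormedSpace ℝ E] :
    C(Icc (-1 : ℝ) 1, E) →L[ℝ] C(Icc (-1 : ℝ) 1, E) :=
  LinearMap.mkContinuous
    { toFun := fun g => ⟨fun τ => ∫ s in (0 : ℝ)..τ, IccExtend (by norm_num : (-1 : ℝ) ≤ 1) g s,
        (intervalIntegral.continuous_primitive (fun _ _ =>
          (ContinuousMap.continuous_IccExtend g).intervalIntegrable _ _) 0).comp
            continuous_subtype_val⟩
      map_add' := fun g h => by
        ext τ
        simpa [IccExtend] using! intervalIntegral.integral_add (a := 0) (b := τ)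
          ((ContinuousMap.continuous_IccExtend g).intervalIntegrable _ _)
          ((ContinuousMap.continuous_IccExtend h).intervalIntegrable _ _)
      map_smul' := fun c g => by
        ext τ
        simp [IccExtend] } 1
    (fun g => by
      rw [one_mul]
      refine (ContinuousMap.norm_le _ (norm_nonneg _)).2 fun τ => ?_
      refine (intervalIntegral.norm_integral_le_of_norm_le_const
        fun s _ => ContinuousMap.norm_IccExtend_le g s).trans ?_
      refine mul_le_of_le_one_right (norm_nonneg _) ?_
      rw [sub_zero]
      exact abs_le.2 τ.2)

theorem ContinuousMap.primitive_apply (g : C(Icc (-1 : ℝ) 1, E)) (τ : Icc (-1 : ℝ) 1) :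
    ContinuousMap.primitive E g τ =
      ∫ s in (0 : ℝ)..τ, IccExtend (by norm_num : (-1 : ℝ) ≤ 1) g s := rfl

/-- The embedding of a space as the constant functions. -/
def ContinuousMap.constL (E : Type u) [NormedAddCommGroup E] [NormedSpace ℝ E] :
    E →L[ℝ] C(Icc (-1 : ℝ) 1, E) :=
  LinearMap.mkContinuous
    { toFun := fun x => ContinuousMap.const _ x
      map_add' := fun _ _ => rfl
      map_smul' := fun _ _ => rfl } 1
    (fun x => by
      rw [one_mul]
      exact (ContinuousMap.norm_le _ (norm_nonneg _)).2 fun τ => le_rfl)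

theorem ContinuousMap.constL_apply (x : E) (τ : Icc (-1 : ℝ) 1) :
    ContinuousMap.constL E x τ = x := rfl

/-- The map whose zeros `((x, ε), γ)` in the last component are the curves `γ` on `[-1, 1]` that
start at `x` and have velocity `ε F`. -/
def flowMap (F : C(E, E)) (z : (E × ℝ) × C(Icc (-1 : ℝ) 1, E)) :
    (E × ℝ) × C(Icc (-1 : ℝ) 1, E) :=
  (z.1, z.2 - ContinuousMap.constL E z.1.1 - z.1.2 • ContinuousMap.primitive E (F.comp z.2))

theorem contDiff_flowMap {F : C(E, E)} (hF : ContDiff ℝ ∞ F) : ContDiff ℝ ∞ (flowMap F) := by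
  have h1 : ContDiff ℝ ∞ fun z : (E × ℝ) × C(Icc (-1 : ℝ) 1, E) =>
      ContinuousMap.primitive E (F.comp z.2) :=
    (ContinuousMap.primitive E).contDiff.comp ((ContinuousMap.contDiff_comp hF).comp contDiff_snd)
  have h2 : ContDiff ℝ ∞ fun z : (E × ℝ) × C(Icc (-1 : ℝ) 1, E) =>
      ContinuousMap.constL E z.1.1 :=
    (ContinuousMap.constL E).contDiff.comp (contDiff_fst.comp contDiff_fst)
  exact contDiff_fst.prodMk ((contDiff_snd.sub h2).sub ((contDiff_snd.comp contDiff_fst).smul h1))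

/-- The shear `(h, η) ↦ (h, η - A h)`. -/
def shear {X Y : Type*} [NormedAddCommGroup X] [NormedSpace ℝ X] [NormedAddCommGroup Y]
    [NormedSpace ℝ Y] (A : X →L[ℝ] Y) : (X × Y) ≃L[ℝ] X × Y :=
  ContinuousLinearEquiv.equivOfInverse
    ((ContinuousLinearMap.fst ℝ X Y).prod
      (ContinuousLinearMap.snd ℝ X Y - A.comp (ContinuousLinearMap.fst ℝ X Y)))
    ((ContinuousLinearMap.fst ℝ X Y).prod
      (ContinuousLinearMap.snd ℝ X Y + A.comp (ContinuousLinearMap.fst ℝ X Y)))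
    (fun z => by ext <;> simp) (fun z => by ext <;> simp)

/-- At ε = 0 the product rule multiplies the derivative of the composition by zero. What remains is
a shear, invertible whatever `F` is. -/
theorem hasFDerivAt_flowMap {F : C(E, E)} (hF : ContDiff ℝ ∞ F) (p : E) :
    HasFDerivAt (flowMap F) (shear ((ContinuousMap.constL E).comp (ContinuousLinearMap.fst ℝ E ℝ)
      + (ContinuousLinearMap.snd ℝ E ℝ).smulRight (ContinuousMap.primitive E
        (F.comp (ContinuousMap.constL E p)))) :
        ((E × ℝ) × C(Icc (-1 : ℝ) 1, E)) →L[ℝ] (E × ℝ) × C(Icc (-1 : ℝ) 1, E))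
      ((p, 0), ContinuousMap.constL E p) := by
  have h1 : ContDiff ℝ ∞ fun z : (E × ℝ) × C(Icc (-1 : ℝ) 1, E) =>
      ContinuousMap.primitive E (F.comp z.2) :=
    (ContinuousMap.primitive E).contDiff.comp ((ContinuousMap.contDiff_comp hF).comp contDiff_snd)
  have h2 := ((h1.differentiable (by simp)) ((p, (0 : ℝ)), ContinuousMap.constL E p)).hasFDerivAt
  have h3 := (((ContinuousLinearMap.snd ℝ E ℝ).comp (ContinuousLinearMap.fst ℝ (E × ℝ)
    C(Icc (-1 : ℝ) 1, E))).hasFDerivAt (x := ((p, (0 : ℝ)), ContinuousMap.constL E p))).smul h2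
  have h4 := ((ContinuousMap.constL E).comp ((ContinuousLinearMap.fst ℝ E ℝ).comp
    (ContinuousLinearMap.fst ℝ (E × ℝ) C(Icc (-1 : ℝ) 1, E)))).hasFDerivAt
    (x := ((p, (0 : ℝ)), ContinuousMap.constL E p))
  have h5 := (ContinuousLinearMap.fst ℝ (E × ℝ) C(Icc (-1 : ℝ) 1, E)).hasFDerivAt
    (x := ((p, (0 : ℝ)), ContinuousMap.constL E p))
  have h6 := (ContinuousLinearMap.snd ℝ (E × ℝ) C(Icc (-1 : ℝ) 1, E)).hasFDerivAt
    (x := ((p, (0 : ℝ)), ContinuousMap.constL E p))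
  refine (h5.prodMk ((h6.sub h4).sub h3)).congr_fderiv ?_
  refine ContinuousLinearMap.ext fun z => ?_
  refine Prod.ext rfl ?_
  simp [shear, sub_sub]

variable [CompleteSpace E]

/-- A smooth vector field has a local flow that is smooth in time and initial value jointly. -/
theorem exists_local_flow {F : E → E} (hF : ContDiff ℝ ∞ F) (p : E) :
    ∃ (φ : E × ℝ → E) (r : ℝ), 0 < r ∧
      ContDiffOn ℝ ∞ φ (Metric.ball p r ×ˢ Metric.ball 0 r) ∧
      (∀ x ∈ Metric.ball p r, φ (x, 0) = x) ∧
      ∀ x ∈ Metric.ball p r, ∀ t ∈ Metric.ball (0 : ℝ) r,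
        HasDerivAt (fun t => φ (x, t)) (F (φ (x, t))) t := by
  let Fc : C(E, E) := ⟨F, hF.continuous⟩
  have hFc : ContDiff ℝ ∞ Fc := hF
  obtain ⟨P, hP, haP, -, hsymm⟩ := exists_openPartialHomeomorph_contDiffOn_symm isOpen_univ
    (mem_univ _) (contDiff_flowMap hFc).contDiffOn _ (hasFDerivAt_flowMap hFc p)
  have ha : flowMap Fc ((p, 0), ContinuousMap.constL E p) = ((p, 0), 0) := by simp [flowMap]
  have htgt : (((p, (0 : ℝ)), (0 : C(Icc (-1 : ℝ) 1, E)))) ∈ P.target := by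
    rw [← ha, ← hP]; exact P.map_source haP
  have hsol : P.symm ((p, 0), 0) = ((p, 0), ContinuousMap.constL E p) := by
    rw [← ha, ← hP]; exact P.left_inv haP
  obtain ⟨r₁, hr₁, hball⟩ := Metric.isOpen_iff.1 P.open_source _ haP
  have hins : Continuous fun q : E × ℝ => (q, (0 : C(Icc (-1 : ℝ) 1, E))) := by fun_prop
  have hnhds : ∀ᶠ q in 𝓝 (p, (0 : ℝ)), (q, (0 : C(Icc (-1 : ℝ) 1, E))) ∈ P.target ∧
      dist (P.symm (q, 0)).2 (ContinuousMap.constL E p) < r₁ := by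
    refine (hins.continuousAt.eventually (P.open_target.mem_nhds htgt)).and ?_
    have hc : ContinuousAt (fun q : E × ℝ => (P.symm (q, (0 : C(Icc (-1 : ℝ) 1, E)))).2) (p, 0) :=
      continuous_snd.continuousAt.comp
        (ContinuousAt.comp (f := fun q : E × ℝ => (q, (0 : C(Icc (-1 : ℝ) 1, E))))
          (P.continuousAt_symm htgt) hins.continuousAt)
    have := Metric.continuousAt_iff'.1 hc r₁ hr₁
    rwa [hsol] at this
  obtain ⟨r₀, hr₀, hr₀ball⟩ := Metric.eventually_nhds_iff.1 hnhds
  let sol : E × ℝ → C(Icc (-1 : ℝ) 1, E) := fun q => (P.symm (q, 0)).2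
  -- Halving keeps the parameter value `r` itself strictly inside both radii, so that `sol (x, r)`
  -- is available as a reference curve.
  let r := min r₀ r₁ / 2
  have hr : 0 < r := by positivity
  have hr0 : r < r₀ := (half_lt_self (by positivity)).trans_le (min_le_left _ _)
  have hr1 : r < r₁ := (half_lt_self (by positivity)).trans_le (min_le_right _ _)
  have hmem : ∀ x t, dist x p < r₀ → dist t 0 < r₀ → dist (x, t) (p, (0 : ℝ)) < r₀ :=
    fun x t hx ht => max_lt hx ht
  have hfst : ∀ q : E × ℝ, dist q (p, 0) < r₀ → P.symm (q, 0) = (q, sol q) := by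
    intro q hq
    have h := P.right_inv (hr₀ball hq).1
    rw [hP] at h
    have h' : (P.symm (q, 0)).1 = q := congrArg (Prod.fst : (E × ℝ) × _ → E × ℝ) h
    exact Prod.ext h' rfl
  have heq : ∀ q : E × ℝ, dist q (p, 0) < r₀ → sol q =
      ContinuousMap.constL E q.1 + q.2 • ContinuousMap.primitive E (Fc.comp (sol q)) := by
    intro q hq
    have h := P.right_inv (hr₀ball hq).1
    rw [hP, hfst q hq] at h
    have h' : sol q - ContinuousMap.constL E q.1
      - q.2 • ContinuousMap.primitive E (Fc.comp (sol q)) = 0 := congrArg Prod.snd h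
    rw [sub_sub, sub_eq_zero] at h'
    exact h'
  have hneg : (-1 : ℝ) ≤ 1 := by norm_num
  -- Rescaling time in the reference curve by t / r gives another zero of the equation, now with
  -- parameter `t`. It stays close to the constant curve `p`, hence lies in the source of `P`, and
  -- injectivity there identifies it with `sol (x, t)`.
  have hscale : ∀ x t, dist x p < r → dist t 0 < r →
      sol (x, t) ⟨1, by norm_num⟩ = IccExtend hneg (sol (x, r)) (t / r) := by
    intro x t hx ht
    rw [dist_zero_right, Real.norm_eq_abs] at ht
    have hl : |t / r| ≤ 1 := by
      rw [abs_div, abs_of_pos hr]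
      exact (div_le_one hr).2 ht.le
    have hlm : ∀ τ : Icc (-1 : ℝ) 1, t / r * τ ∈ Icc (-1 : ℝ) 1 := fun τ => by
      refine abs_le.1 ?_
      rw [abs_mul]
      exact mul_le_one₀ hl (abs_nonneg _) (abs_le.2 τ.2)
    let δ : C(Icc (-1 : ℝ) 1, E) := (sol (x, r)).comp
      ⟨fun τ => ⟨t / r * τ, hlm τ⟩, by fun_prop⟩
    have hq : dist (x, r) (p, (0 : ℝ)) < r₀ := hmem x r (hx.trans hr0) (by
      rwa [dist_zero_right, Real.norm_of_nonneg hr.le])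
    have hq' : dist (x, t) (p, (0 : ℝ)) < r₀ := hmem x t (hx.trans hr0) (by
      rw [dist_zero_right, Real.norm_eq_abs]; exact ht.trans hr0)
    have hδ : flowMap Fc ((x, t), δ) = ((x, t), 0) := by
      refine Prod.ext rfl ?_
      change δ - ContinuousMap.constL E x - t • ContinuousMap.primitive E (Fc.comp δ) = 0
      rw [sub_sub, sub_eq_zero]
      ext τ
      have h1 := DFunLike.congr_fun (heq (x, r) hq) ⟨t / r * τ, hlm τ⟩
      change sol (x, r) ⟨t / r * τ, hlm τ⟩ = _
      rw [h1]
      simp only [ContinuousMap.add_apply, ContinuousMap.smul_apply, ContinuousMap.constL_apply,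
        ContinuousMap.primitive_apply]
      congr 1
      have h2 : ∫ s in (0 : ℝ)..τ, IccExtend hneg (Fc.comp δ) s =
          ∫ s in (0 : ℝ)..τ, IccExtend hneg (Fc.comp (sol (x, r))) (t / r * s) := by
        refine intervalIntegral.integral_congr fun s hs => ?_
        have hs' : s ∈ Icc (-1 : ℝ) 1 := by
          have h0 : (0 : ℝ) ∈ Icc (-1 : ℝ) 1 := by norm_num
          exact (convex_Icc (-1 : ℝ) 1).ordConnected.uIcc_subset h0 τ.2 hs
        rw [IccExtend_of_mem _ _ hs', IccExtend_of_mem _ _ (hlm ⟨s, hs'⟩)]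
        rfl
      rw [h2]
      have h3 := intervalIntegral.smul_integral_comp_mul_left (a := 0) (b := (τ : ℝ))
        (IccExtend hneg (Fc.comp (sol (x, r)))) (t / r)
      rw [mul_zero] at h3
      rw [← h3, smul_smul, mul_div_cancel₀ _ hr.ne']
    have hsrc : ((x, t), δ) ∈ P.source := by
      refine hball ?_
      have hd : dist δ (ContinuousMap.constL E p) < r₁ := by
        refine lt_of_le_of_lt ?_ (hr₀ball hq).2
        refine (ContinuousMap.dist_le dist_nonneg).2 fun τ => ?_
        exact ContinuousMap.dist_apply_le_dist (f := sol (x, r)) (g := ContinuousMap.constL E p)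
          ⟨t / r * τ, hlm τ⟩
      refine max_lt (max_lt (hx.trans hr1) ?_) hd
      rw [dist_zero_right, Real.norm_eq_abs]; exact ht.trans hr1
    have h4 : P.symm ((x, t), 0) = ((x, t), δ) := by
      rw [← hδ, ← hP]; exact P.left_inv hsrc
    have h5 : sol (x, t) = δ := congrArg Prod.snd h4
    rw [h5]
    have hm := hlm ⟨1, by norm_num⟩
    rw [mul_one] at hm
    rw [IccExtend_of_mem _ _ hm]
    change sol (x, r) ⟨t / r * 1, _⟩ = _
    congr 1
    exact Subtype.ext (mul_one _)
  refine ⟨fun q => sol q ⟨1, by norm_num⟩, r, hr, ?_, ?_, ?_⟩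
  · have hev : ContDiff ℝ ∞ fun z : (E × ℝ) × C(Icc (-1 : ℝ) 1, E) =>
        z.2 ⟨(1 : ℝ), by norm_num⟩ :=
      ((ContinuousMap.evalCLM ℝ (⟨1, by norm_num⟩ : Icc (-1 : ℝ) 1)).comp
        (ContinuousLinearMap.snd ℝ (E × ℝ) C(Icc (-1 : ℝ) 1, E))).contDiff
    refine hev.comp_contDiffOn (hsymm.comp (contDiff_id.prodMk contDiff_const).contDiffOn ?_)
    rintro ⟨x, t⟩ ⟨hx, ht⟩
    exact (hr₀ball (hmem x t (lt_trans hx hr0) (lt_trans ht hr0))).1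
  · intro x hx
    have h := heq (x, 0) (hmem x 0 (lt_trans hx hr0) (by simpa using hr₀))
    simp only [zero_smul, add_zero] at h
    change sol (x, 0) _ = x
    rw [h, ContinuousMap.constL_apply]
  · intro x hx t ht
    let g := sol (x, r)
    have hq : dist (x, r) (p, (0 : ℝ)) < r₀ := hmem x r (lt_trans hx hr0) (by
      rwa [dist_zero_right, Real.norm_of_nonneg hr.le])
    -- All times are now read off one fixed curve, so differentiation in `t` reduces to the
    -- fundamental theorem of calculus.
    have hg : ∀ t ∈ Metric.ball (0 : ℝ) r, sol (x, t) ⟨1, by norm_num⟩ =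
        x + r • ∫ s in (0 : ℝ)..(t / r), F (IccExtend hneg g s) := by
      intro t ht
      rw [hscale x t hx ht]
      rw [Metric.mem_ball, dist_zero_right, Real.norm_eq_abs] at ht
      have hl : t / r ∈ Icc (-1 : ℝ) 1 := by
        refine abs_le.1 ?_
        rw [abs_div, abs_of_pos hr]
        exact (div_le_one hr).2 ht.le
      rw [IccExtend_of_mem _ _ hl]
      exact DFunLike.congr_fun (heq (x, r) hq) ⟨t / r, hl⟩
    have hc : Continuous fun s => F (IccExtend hneg g s) :=
      hF.continuous.comp (ContinuousMap.continuous_IccExtend g)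
    have h1 : HasDerivAt (fun u => ∫ s in (0 : ℝ)..u, F (IccExtend hneg g s))
        (F (IccExtend hneg g (t / r))) (t / r) :=
      intervalIntegral.integral_hasDerivAt_right (hc.intervalIntegrable _ _)
        (hc.stronglyMeasurableAtFilter _ _) hc.continuousAt
    have h2 : HasDerivAt (fun t : ℝ => t / r) (1 / r) t := (hasDerivAt_id t).div_const r
    have h3 := ((h1.scomp t h2).const_smul r).const_add x
    rw [smul_smul, mul_one_div_cancel hr.ne', one_smul, ← hscale x t hx ht] at h3
    refine h3.congr_of_eventuallyEq ?_
    filter_upwards [Metric.isOpen_ball.mem_nhds ht] with u hu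
    exact hg u hu

end Flow

/-! ### Linear transport equations by the method of characteristics. -/

section Transport

open Set Filter Topology

universe u

variable {E : Type u} [NormedAddCommGroup E] [NormedSpace ℝ E]

/-- The splitting of `E` into a hyperplane and a transversal line. -/
def kerProdEquiv (l : E →L[ℝ] ℝ) (v : E) (hv : l v = 1) : (l.ker × ℝ) ≃L[ℝ] E :=
  ContinuousLinearEquiv.equivOfInverse
    (l.ker.subtypeL.comp (ContinuousLinearMap.fst ℝ l.ker ℝ)
      + (ContinuousLinearMap.snd ℝ l.ker ℝ).smulRight v)
    (((ContinuousLinearMap.id ℝ E - l.smulRight v).codRestrict l.ker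
      (fun w => by simp [hv])).prod l)
    (fun z => by
      have hz : l (z.1 : E) = 0 := z.1.2
      ext <;> simp [hv, hz])
    (fun w => by simp)

/-- A linear transport equation `F · ∇ θ = g` has smooth local solutions where `F ≠ 0`. -/
theorem exists_local_solution_transport [CompleteSpace E] {F : E → E} {g : E → ℝ}
    (hF : ContDiff ℝ ∞ F) (hg : ContDiff ℝ ∞ g) {p : E} (hp : F p ≠ 0) :
    ∃ (S : Set E) (θ : E → ℝ), IsOpen S ∧ p ∈ S ∧ ContDiffOn ℝ ∞ θ S ∧
      ∀ x ∈ S, fderiv ℝ θ x (F x) = g x := by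
  -- The extra coordinate accumulates `g` along integral curves of `F`. Starting it at 0 on the
  -- hyperplane `p + l.ker`, transversal to `F p`, its value is the desired θ.
  obtain ⟨φ, r, hr, hφ, hφ0, hφt⟩ := exists_local_flow (E := E × ℝ)
    (F := fun z => (F z.1, g z.1))
    ((hF.comp contDiff_fst).prodMk (hg.comp contDiff_fst)) (p, 0)
  obtain ⟨l, hl⟩ := SeparatingDual.exists_eq_one (R := ℝ) hp
  let ins : l.ker × ℝ → (E × ℝ) × ℝ := fun z => ((p + z.1, 0), z.2)
  have hins : ContDiff ℝ ∞ ins :=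
    ((contDiff_const.add (l.ker.subtypeL.contDiff.comp contDiff_fst)).prodMk contDiff_const).prodMk
      contDiff_snd
  let S₀ : Set (l.ker × ℝ) := ins ⁻¹' (Metric.ball (p, 0) r ×ˢ Metric.ball 0 r)
  have hS₀ : IsOpen S₀ := (Metric.isOpen_ball.prod Metric.isOpen_ball).preimage hins.continuous
  have h0S₀ : (0 : l.ker × ℝ) ∈ S₀ := by
    refine ⟨?_, Metric.mem_ball_self hr⟩
    change (p + ((0 : l.ker) : E), (0 : ℝ)) ∈ Metric.ball (p, 0) r
    simpa using hr
  let Φ : l.ker × ℝ → E × ℝ := φ ∘ ins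
  have hΦ : ContDiffOn ℝ ∞ Φ S₀ := hφ.comp hins.contDiffOn fun z hz => hz
  let G : l.ker × ℝ → E := fun z => (Φ z).1
  have hG : ContDiffOn ℝ ∞ G S₀ := contDiff_fst.comp_contDiffOn hΦ
  have hΦt : ∀ z ∈ S₀, HasDerivAt (fun s => Φ (z.1, s)) (F (G z), g (G z)) z.2 := fun z hz =>
    hφt _ hz.1 _ hz.2
  have hGt : ∀ z ∈ S₀, HasDerivAt (fun s => G (z.1, s)) (F (G z)) z.2 := fun z hz => (hΦt z hz).fst
  have hG0' : ∀ h : l.ker, (h, (0 : ℝ)) ∈ S₀ → G (h, 0) = p + h := fun h hh => by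
    change (φ ((p + h, 0), 0)).1 = _
    rw [hφ0 _ hh.1]
  have hG0 : G 0 = p := (hG0' 0 h0S₀).trans (by simp)
  have hGd : HasFDerivAt G (fderiv ℝ G 0) 0 :=
    ((hG.contDiffAt (hS₀.mem_nhds h0S₀)).differentiableAt (by simp)).hasFDerivAt
  have hd1 : ∀ h : l.ker, fderiv ℝ G 0 (h, 0) = h := by
    intro h
    have h1 : HasFDerivAt (fun k : l.ker => (k, (0 : ℝ)))
        (ContinuousLinearMap.inl ℝ l.ker ℝ) 0 := (ContinuousLinearMap.inl ℝ l.ker ℝ).hasFDerivAt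
    have h2 := HasFDerivAt.comp (g := G) (0 : l.ker) hGd h1
    have h3 : HasFDerivAt (fun k : l.ker => p + (k : E)) l.ker.subtypeL 0 :=
      l.ker.subtypeL.hasFDerivAt.const_add p
    have h4 : G ∘ (fun k : l.ker => (k, (0 : ℝ))) =ᶠ[𝓝 0] fun k : l.ker => p + (k : E) := by
      have hc : Continuous fun k : l.ker => (k, (0 : ℝ)) := by fun_prop
      filter_upwards [hc.continuousAt.preimage_mem_nhds (hS₀.mem_nhds h0S₀)] with k hk
      exact hG0' k hk
    have h5 := h2.unique (h3.congr_of_eventuallyEq h4)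
    exact DFunLike.congr_fun h5 h
  have hd2 : fderiv ℝ G 0 (0, 1) = F p := by
    have h1 : HasDerivAt (fun s : ℝ => ((0 : l.ker), s)) ((0 : l.ker), (1 : ℝ)) 0 :=
      (hasDerivAt_const _ _).prodMk (hasDerivAt_id _)
    have h2 := HasFDerivAt.comp_hasDerivAt (l := G) (0 : ℝ) hGd h1
    have h3 := hGt 0 h0S₀
    rw [hG0] at h3
    exact h2.unique h3
  -- `G` is the identity shift on the hyperplane and moves with velocity `F p` across it, so
  -- (hyperplane point, time) are local coordinates.
  have hGe : HasFDerivAt G (kerProdEquiv l (F p) hl : (l.ker × ℝ) →L[ℝ] E) 0 := by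
    refine hGd.congr_fderiv (ContinuousLinearMap.ext fun z => ?_)
    have hz : z = (z.1, 0) + z.2 • ((0 : l.ker), (1 : ℝ)) := by ext <;> simp
    conv_lhs => rw [hz]
    rw [map_add, map_smul, hd1, hd2]
    rfl
  obtain ⟨P, hP, h0P, hPS, hsymm⟩ := exists_openPartialHomeomorph_contDiffOn_symm hS₀ h0S₀ hG _ hGe
  have hθ : ContDiffOn ℝ ∞ (fun x => (Φ (P.symm x)).2) P.target :=
    contDiff_snd.comp_contDiffOn (hΦ.comp hsymm fun x hx => hPS (P.map_target hx))
  refine ⟨P.target, _, P.open_target, ?_, hθ, ?_⟩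
  · rw [← hG0, ← hP]; exact P.map_source h0P
  · intro x hx
    have hz := P.map_target hx
    have hx' : G (P.symm x) = x := by rw [← hP]; exact P.right_inv hx
    have h1 := hGt _ (hPS hz)
    have h2 : HasDerivAt (fun s => (Φ ((P.symm x).1, s)).2) (g (G (P.symm x))) (P.symm x).2 :=
      (hΦt _ (hPS hz)).snd
    have h3 := ((hθ.contDiffAt (P.open_target.mem_nhds hx)).differentiableAt
      (by simp)).hasFDerivAt
    rw [hx'] at h1 h2
    rw [← hx'] at h3
    have h4 := HasFDerivAt.comp_hasDerivAt (f := fun s => G ((P.symm x).1, s)) (P.symm x).2 h3 h1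
    rw [hx'] at h4
    refine h4.unique (h2.congr_of_eventuallyEq ?_)
    have hc : Continuous fun s : ℝ => ((P.symm x).1, s) := by fun_prop
    filter_upwards [hc.continuousAt.preimage_mem_nhds (P.open_source.mem_nhds hz)] with s hs
    -- Along a characteristic the coordinates change only in time, so θ restricted to it is the
    -- accumulated coordinate.
    have h5 : P.symm (G ((P.symm x).1, s)) = ((P.symm x).1, s) := by
      rw [← hP]; exact P.left_inv hs
    simp only [Function.comp_apply, h5]

/-- A function that is smooth on an open set agrees near each point of it with a function that is
smooth everywhere. -/
theorem exists_contDiff_eventuallyEq {W : Type*} [NormedAddCommGroup W] [NormedSpace ℝ W]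
    [HasContDiffBump E] {F : E → W} {S : Set E} (hS : IsOpen S) (hF : ContDiffOn ℝ ∞ F S) {p : E}
    (hp : p ∈ S) : ∃ F' : E → W, ContDiff ℝ ∞ F' ∧ F' =ᶠ[𝓝 p] F := by
  obtain ⟨r, hr, hrS⟩ := Metric.isOpen_iff.1 hS p hp
  let χ : ContDiffBump p := ⟨r / 4, r / 2, by positivity, by linarith⟩
  refine ⟨fun x => χ x • F x, contDiff_iff_contDiffAt.2 fun x => ?_, ?_⟩
  · by_cases hx : x ∈ Metric.ball p r
    · exact χ.contDiff.contDiffAt.smul (hF.contDiffAt (hS.mem_nhds (hrS hx)))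
    · have hx' : x ∉ tsupport χ := by
        rw [χ.tsupport_eq]
        intro h
        have h1 : dist x p ≤ r / 2 := h
        exact hx (show dist x p < r by linarith)
      refine (contDiffAt_const (c := (0 : W))).congr_of_eventuallyEq ?_
      filter_upwards [(isClosed_tsupport χ).isOpen_compl.mem_nhds hx'] with y hy
      rw [image_eq_zero_of_notMem_tsupport hy, zero_smul]
  · filter_upwards [χ.eventuallyEq_one] with x hx
    simp only [hx, Pi.one_apply, one_smul]

end Transport

/-! ### The transport equation in a chart of the manifold. -/

section ManifoldTransport

open Set Filter Topology

variable {M : Type*} [TopologicalSpace M] [ChartedSpace (EuclideanSpace ℝ (Fin 3)) M]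
  [IsManifold (𝓡 3) ∞ M]

/-- The linear transport equation `X θ = f` has smooth local solutions where `X ≠ 0`. -/
theorem exists_local_solution_mvfderiv {X : VField M} {f : M → ℝ} {U : Set M} (hU : IsOpen U)
    {p : M} (hp : p ∈ U) (hX : ∀ x ∈ U, VSmoothAt X x) (hf : ContMDiffOn (𝓡 3) 𝓘(ℝ, ℝ) ∞ f U)
    (hXp : X p ≠ 0) : ∃ (V : Set M) (θ : M → ℝ), IsOpen V ∧ p ∈ V ∧ V ⊆ U ∧
      ContMDiffOn (𝓡 3) 𝓘(ℝ, ℝ) ∞ θ V ∧ ∀ x ∈ V, mvfderiv (𝓡 3) θ x (X x) = f x := by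
  let φ := extChartAt (𝓡 3) p
  let F : EuclideanSpace ℝ (Fin 3) → EuclideanSpace ℝ (Fin 3) := fun y =>
    mfderiv (𝓡 3) 𝓘(ℝ, EuclideanSpace ℝ (Fin 3)) φ (φ.symm y) (X (φ.symm y))
  let S : Set (EuclideanSpace ℝ (Fin 3)) := φ.target ∩ φ.symm ⁻¹' U
  have hS : IsOpen S := (continuousOn_extChartAt_symm p).isOpen_inter_preimage
    (isOpen_extChartAt_target p) hU
  have hpS : φ p ∈ S := ⟨mem_extChartAt_target p, by
    rw [mem_preimage, extChartAt_to_inv]; exact hp⟩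
  have hsymm : ContMDiffOn 𝓘(ℝ, EuclideanSpace ℝ (Fin 3)) (𝓡 3) ∞ φ.symm φ.target :=
    contMDiffOn_extChartAt_symm p
  have hXφ : ∀ x ∈ φ.source ∩ U, ContMDiffAt (𝓡 3) 𝓘(ℝ, EuclideanSpace ℝ (Fin 3)) ∞
      (fun y => (mfderiv (𝓡 3) 𝓘(ℝ, EuclideanSpace ℝ (Fin 3)) φ y (X y) :
        EuclideanSpace ℝ (Fin 3))) x := by
    intro x hx
    let τ := trivializationAt (EuclideanSpace ℝ (Fin 3)) (TangentSpace (𝓡 3) : M → Type _) p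
    have hφs : φ.source = (chartAt (EuclideanSpace ℝ (Fin 3)) p).source := extChartAt_source _ p
    have hbase : τ.baseSet = φ.source :=
      (TangentBundle.trivializationAt_baseSet p).trans hφs.symm
    -- On the chart domain the differential of the chart is the tangent bundle trivialization, so
    -- smoothness of the section is smoothness of its chart representative.
    refine ((τ.contMDiffAt_section_iff (hbase ▸ hx.1)).1 (hX x hx.2)).congr_of_eventuallyEq ?_
    filter_upwards [(isOpen_extChartAt_source p).mem_nhds hx.1] with y hy
    have h1 := TangentBundle.continuousLinearMapAt_trivializationAt (I := 𝓡 3) (𝕜 := ℝ)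
      (x₀ := p) (x := y) (hφs ▸ hy)
    have h2 : τ.continuousLinearMapAt ℝ y (X y) = (τ ⟨y, X y⟩).2 := by
      rw [Trivialization.continuousLinearMapAt_apply, Trivialization.linearMapAt_apply,
        if_pos (by rw [hbase]; exact hy)]
    exact (DFunLike.congr_fun h1 (X y)).symm.trans h2
  have hF : ContDiffOn ℝ ∞ F S := by
    rw [← contMDiffOn_iff_contDiffOn]
    intro y hy
    exact ((hXφ _ ⟨φ.map_target hy.1, hy.2⟩).comp_contMDiffWithinAt y
      ((hsymm y hy.1).mono inter_subset_left))
  have hg : ContDiffOn ℝ ∞ (f ∘ φ.symm) S := by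
    rw [← contMDiffOn_iff_contDiffOn]
    exact hf.comp (hsymm.mono inter_subset_left) fun y hy => hy.2
  -- The flow is constructed for globally smooth data, so both functions are cut off away from the
  -- point; the equation is later used only where nothing was changed.
  obtain ⟨F', hF', hFF'⟩ := exists_contDiff_eventuallyEq hS hF hpS
  obtain ⟨g', hg', hgg'⟩ := exists_contDiff_eventuallyEq hS hg hpS
  have hF'p : F' (φ p) ≠ 0 := by
    rw [hFF'.eq_of_nhds]
    change mfderiv (𝓡 3) 𝓘(ℝ, EuclideanSpace ℝ (Fin 3)) φ (φ.symm (φ p)) (X (φ.symm (φ p))) ≠ 0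
    rw [φ.left_inv (mem_extChartAt_source p)]
    intro h0
    exact hXp ((isInvertible_mfderiv_extChartAt (mem_extChartAt_source p)).injective
      (h0.trans (map_zero _).symm))
  obtain ⟨T, θ, hT, hpT, hθ, hθF⟩ := exists_local_solution_transport hF' hg' hF'p
  obtain ⟨T', hT'sub, hT', hpT'⟩ := mem_nhds_iff.1 (hFF'.and hgg')
  let V : Set M := φ.source ∩ φ ⁻¹' (T ∩ T' ∩ S)
  have hV : IsOpen V := (continuousOn_extChartAt p).isOpen_inter_preimage
    (isOpen_extChartAt_source p) ((hT.inter hT').inter hS)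
  refine ⟨V, θ ∘ φ, hV, ⟨mem_extChartAt_source p, ⟨hpT, hpT'⟩, hpS⟩, ?_, ?_, ?_⟩
  · rintro x ⟨hx, -, -, hxU⟩
    rwa [mem_preimage, φ.left_inv hx] at hxU
  · exact hθ.contMDiffOn.comp ((contMDiffOn_extChartAt (n := ∞)).mono fun x hx => by
      rw [← extChartAt_source (𝓡 3)]; exact hx.1) fun x hx => hx.2.1.1
  · rintro x ⟨hx, ⟨hxT, hxT'⟩, hxS⟩
    have hθd : MDifferentiableAt 𝓘(ℝ, EuclideanSpace ℝ (Fin 3)) 𝓘(ℝ, ℝ) θ (φ x) :=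
      ((hθ.contDiffAt (hT.mem_nhds hxT)).differentiableAt (by simp)).mdifferentiableAt
    have hφd : MDifferentiableAt (𝓡 3) 𝓘(ℝ, EuclideanSpace ℝ (Fin 3)) φ x :=
      mdifferentiableAt_extChartAt (by rw [← extChartAt_source (𝓡 3)]; exact hx)
    have h1 : F' (φ x) = F (φ x) := (hT'sub hxT').1
    have h2 : g' (φ x) = f (φ.symm (φ x)) := (hT'sub hxT').2
    have h3 : F (φ x) = mfderiv (𝓡 3) 𝓘(ℝ, EuclideanSpace ℝ (Fin 3)) φ x (X x) := by
      change mfderiv (𝓡 3) 𝓘(ℝ, EuclideanSpace ℝ (Fin 3)) φ (φ.symm (φ x)) (X (φ.symm (φ x))) = _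
      rw [φ.left_inv hx]
    have h4 := hθF _ hxT
    rw [h1, h2, φ.left_inv hx, h3] at h4
    rw [← h4, mvfderiv, mfderiv_comp x hθd hφd, mfderiv_eq_fderiv]
    rfl

end ManifoldTransport

/-! ### Rotations of the frame about the director and the gauge choices. -/

section Composition

variable {M : Type*} [TopologicalSpace M] [ChartedSpace (EuclideanSpace ℝ (Fin 3)) M]
  {e : Fin 3 → VField M} {i : Fin 3} {x : M}

theorem D_comp {θ : M → ℝ} {g : ℝ → ℝ} {g' : ℝ} (hθ : MDifferentiableAt (𝓡 3) 𝓘(ℝ, ℝ) θ x)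
    (hg : HasDerivAt g g' (θ x)) :
    MDifferentiableAt (𝓡 3) 𝓘(ℝ, ℝ) (fun y => g (θ y)) x ∧
      D e i (fun y => g (θ y)) x = g' * D e i θ x := by
  have hg1 : MDifferentiableAt 𝓘(ℝ, ℝ) 𝓘(ℝ, ℝ) g (θ x) := hg.differentiableAt.mdifferentiableAt
  refine ⟨hg1.comp x hθ, (mvfderiv_comp_apply x hg1 hθ (e i x)).trans ?_⟩
  have h1 : mvfderiv 𝓘(ℝ, ℝ) g (θ x) = fderiv ℝ g (θ x) := mfderiv_eq_fderiv
  rw [h1, hg.hasFDerivAt.fderiv, mul_comm]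
  rfl

end Composition

section Angle

variable {M : Type*} [TopologicalSpace M] [ChartedSpace (EuclideanSpace ℝ (Fin 3)) M]

/-- Near a point where the planar vector `(a, b)` does not vanish, its direction is given by a
smooth angle. -/
theorem exists_smooth_angle {a b : M → ℝ} {U : Set M} (hU : IsOpen U)
    (ha : ContMDiffOn (𝓡 3) 𝓘(ℝ, ℝ) ∞ a U) (hb : ContMDiffOn (𝓡 3) 𝓘(ℝ, ℝ) ∞ b U) {p : M}
    (hp : p ∈ U) (h : a p ^ 2 + b p ^ 2 ≠ 0) :
    ∃ (V : Set M) (θ : M → ℝ), IsOpen V ∧ p ∈ V ∧ V ⊆ U ∧ ContMDiffOn (𝓡 3) 𝓘(ℝ, ℝ) ∞ θ V ∧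
      ∀ x ∈ V, Real.cos (θ x) * b x - Real.sin (θ x) * a x = 0 := by
  -- The arctangent gives the angle only up to π, which suffices because the conclusion concerns the
  -- line through (a, b). The two cases choose which quotient is defined.
  by_cases hap : a p = 0
  · have hbp : b p ≠ 0 := fun hbp => h (by rw [hap, hbp]; norm_num)
    have hV : IsOpen (U ∩ b ⁻¹' {0}ᶜ) :=
      hb.continuousOn.isOpen_inter_preimage hU isOpen_compl_singleton
    refine ⟨U ∩ b ⁻¹' {0}ᶜ, fun x => Real.pi / 2 - Real.arctan (a x / b x), hV, ⟨hp, hbp⟩,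
      Set.inter_subset_left, ?_, fun x hx => ?_⟩
    · exact contMDiffOn_const.sub (Real.contDiff_arctan.contMDiff.comp_contMDiffOn
        ((ha.mono Set.inter_subset_left).div₀ (hb.mono Set.inter_subset_left) fun x hx => hx.2))
    · have hbx : b x ≠ 0 := hx.2
      have hc := (Real.cos_arctan_pos (a x / b x)).ne'
      have ht := Real.tan_eq_sin_div_cos (Real.arctan (a x / b x))
      rw [Real.tan_arctan, eq_div_iff hc] at ht
      rw [Real.cos_pi_div_two_sub, Real.sin_pi_div_two_sub, ← ht]
      field_simp
      ring
  · have hV : IsOpen (U ∩ a ⁻¹' {0}ᶜ) :=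
      ha.continuousOn.isOpen_inter_preimage hU isOpen_compl_singleton
    refine ⟨U ∩ a ⁻¹' {0}ᶜ, fun x => Real.arctan (b x / a x), hV, ⟨hp, hap⟩,
      Set.inter_subset_left, ?_, fun x hx => ?_⟩
    · exact Real.contDiff_arctan.contMDiff.comp_contMDiffOn
        ((hb.mono Set.inter_subset_left).div₀ (ha.mono Set.inter_subset_left) fun x hx => hx.2)
    · have hax : a x ≠ 0 := hx.2
      have hc := (Real.cos_arctan_pos (b x / a x)).ne'
      have ht := Real.tan_eq_sin_div_cos (Real.arctan (b x / a x))
      rw [Real.tan_arctan, eq_div_iff hc] at ht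
      rw [← ht]
      field_simp
      ring

end Angle

section RotFrame

variable {M : Type*} [TopologicalSpace M] [ChartedSpace (EuclideanSpace ℝ (Fin 3)) M]
  {e : Fin 3 → VField M} {θ : M → ℝ}

theorem rotFrame_zero : rotFrame e θ 0 = e 0 := rfl

theorem rotFrame_one : rotFrame e θ 1 =
    fun x => Real.cos (θ x) • e 1 x + Real.sin (θ x) • e 2 x := rfl

theorem rotFrame_two : rotFrame e θ 2 =
    fun x => -Real.sin (θ x) • e 1 x + Real.cos (θ x) • e 2 x := rfl

end RotFrame

section Rotation

variable {M : Type*} [TopologicalSpace M] [ChartedSpace (EuclideanSpace ℝ (Fin 3)) M]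
  [IsManifold (𝓡 3) ∞ M] [RiemannianBundle (fun x : M => TangentSpace (𝓡 3) x)]
  {e : Fin 3 → VField M} {U V : Set M} {x : M} {θ : M → ℝ}

theorem IsOrthonormalFrameOn.mono (he : IsOrthonormalFrameOn e U) (hVU : V ⊆ U) :
    IsOrthonormalFrameOn e V :=
  ⟨fun i => (he.contMDiffOn i).mono hVU, fun x hx => he.orthonormal x (hVU hx)⟩

theorem IsOrthonormalFrameOn.rotFrame (he : IsOrthonormalFrameOn e V)
    (hθ : ContMDiffOn (𝓡 3) 𝓘(ℝ, ℝ) ∞ θ V) : IsOrthonormalFrameOn (rotFrame e θ) V := by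
  have hcos : ContMDiffOn (𝓡 3) 𝓘(ℝ, ℝ) ∞ (fun x => Real.cos (θ x)) V :=
    Real.contDiff_cos.contMDiff.comp_contMDiffOn hθ
  have hsin : ContMDiffOn (𝓡 3) 𝓘(ℝ, ℝ) ∞ (fun x => Real.sin (θ x)) V :=
    Real.contDiff_sin.contMDiff.comp_contMDiffOn hθ
  have hnsin : ContMDiffOn (𝓡 3) 𝓘(ℝ, ℝ) ∞ (fun x => -Real.sin (θ x)) V :=
    (Real.contDiff_sin.neg).contMDiff.comp_contMDiffOn hθ
  constructor
  · intro i
    fin_cases i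
    · exact he.contMDiffOn 0
    · exact (hcos.smul_section (he.contMDiffOn 1)).add_section
        (hsin.smul_section (he.contMDiffOn 2))
    · exact (hnsin.smul_section (he.contMDiffOn 1)).add_section
        (hcos.smul_section (he.contMDiffOn 2))
  · intro x hx
    have hi := he.inner_eq hx
    have hcs := Real.sin_sq_add_cos_sq (θ x)
    rw [orthonormal_iff_ite]
    intro i j
    fin_cases i <;> fin_cases j <;>
      simp [rotFrame_zero, rotFrame_one, rotFrame_two, inner_add_left, inner_add_right,
        inner_smul_left, inner_smul_right, hi, -inner_self_eq_norm_sq_to_K] <;>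
      first | linear_combination hcs | ring

variable {nabla : CovariantDerivative (𝓡 3) (EuclideanSpace ℝ (Fin 3))
  (fun x : M => TangentSpace (𝓡 3) x)}

theorem modes_rotFrame_bx : (modes nabla (rotFrame e θ)).bx x =
    Real.cos (θ x) * (modes nabla e).bx x - Real.sin (θ x) * (modes nabla e).bp x := by
  simp only [modes, rotFrame_zero, rotFrame_two, inner_add_right, inner_smul_right]
  ring

variable [IsContMDiffRiemannianBundle (𝓡 3) ∞ (EuclideanSpace ℝ (Fin 3))
  (fun x : M => TangentSpace (𝓡 3) x)]

/-- Differentiating the rotation coefficients adds n·∇θ; the algebraic part leaves ω₁ unchanged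
since planar rotations commute. Hence ω₁ = 0 becomes a transport equation. -/
theorem IsLeviCivita.aux_rotFrame_w1 (h : IsLeviCivita nabla) (he : IsOrthonormalFrameOn e V)
    (hV : IsOpen V) (hx : x ∈ V) (hθ : ContMDiffOn (𝓡 3) 𝓘(ℝ, ℝ) ∞ θ V) :
    (aux nabla (rotFrame e θ)).w1 x = (aux nabla e).w1 x + D e 0 θ x := by
  have hθx : MDifferentiableAt (𝓡 3) 𝓘(ℝ, ℝ) θ x :=
    (hθ.contMDiffAt (hV.mem_nhds hx)).mdifferentiableAt (by simp)
  have e1 := (he.smoothAt hV hx 1).vDiffAt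
  have e2 := (he.smoothAt hV hx 2).vDiffAt
  obtain ⟨hc, hc'⟩ := D_comp (e := e) (i := 0) hθx (Real.hasDerivAt_cos (θ x))
  obtain ⟨hs, hs'⟩ := D_comp (e := e) (i := 0) hθx (Real.hasDerivAt_sin (θ x))
  have g1 : inner ℝ (nabla (e 1) x (e 0 x)) (e 1 x) = (0 : ℝ) := h.gam_self he hV hx 0 1
  have g2 : inner ℝ (nabla (e 2) x (e 0 x)) (e 2 x) = (0 : ℝ) := h.gam_self he hV hx 0 2
  have g21 : inner ℝ (nabla (e 2) x (e 0 x)) (e 1 x) =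
    (-inner ℝ (nabla (e 1) x (e 0 x)) (e 2 x) : ℝ) := h.gam_antisymm he hV hx 0 2 1
  have hcs := Real.sin_sq_add_cos_sq (θ x)
  simp only [D] at hc' hs'
  simp only [aux, D, rotFrame_zero, rotFrame_one, rotFrame_two]
  rw [nabla_add (e1.smul hc) (e2.smul hs), add_apply, nabla_smul e1 hc,
    nabla_smul e2 hs, hc', hs']
  simp only [inner_add_left, inner_add_right, inner_smul_left, inner_smul_right, conj_trivial,
    g1, g2, g21, he.inner_eq hx, Fin.reduceEq, if_true, if_false]
  linear_combination (inner ℝ (nabla (e 1) x (e 0 x)) (e 2 x) + mvfderiv (𝓡 3) θ x (e 0 x)) * hcs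

/-- A traceless symmetric 2-tensor has spin two, hence the double angle. No derivative of θ appears
because the director itself is not rotated. -/
theorem IsLeviCivita.modes_rotFrame_d2 (h : IsLeviCivita nabla) (he : IsOrthonormalFrameOn e V)
    (hV : IsOpen V) (hx : x ∈ V) (hθ : ContMDiffOn (𝓡 3) 𝓘(ℝ, ℝ) ∞ θ V) :
    (modes nabla (rotFrame e θ)).d2 x =
      Real.cos (2 * θ x) * (modes nabla e).d2 x - Real.sin (2 * θ x) * (modes nabla e).d1 x := by
  rw [(he.rotFrame hθ).modes_d2 hx, he.modes_d2 hx, h.modes_d1 he hV hx, Real.cos_two_mul,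
    Real.sin_two_mul]
  simp only [gam, rotFrame_zero, rotFrame_one, rotFrame_two, map_add, map_smul, inner_add_left,
    inner_add_right, inner_smul_left, inner_smul_right, conj_trivial]
  have hcs := Real.sin_sq_add_cos_sq (θ x)
  linear_combination (-(inner ℝ (nabla (e 0) x (e 1 x)) (e 2 x) +
    inner ℝ (nabla (e 0) x (e 2 x)) (e 1 x)) / 2) * hcs

/-- Near a point with non-vanishing biaxial splay, some rotation of the frame about the director
diagonalizes the biaxial splay. -/
theorem IsLeviCivita.exists_rotFrame_d2_eq_zero (h : IsLeviCivita nabla)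
    (he : IsOrthonormalFrameOn e U) (hU : IsOpen U) {p : M} (hp : p ∈ U)
    (hD : (modes nabla e).Dsq p ≠ 0) :
    ∃ (V : Set M) (θ : M → ℝ), IsOpen V ∧ p ∈ V ∧ V ⊆ U ∧ ContMDiffOn (𝓡 3) 𝓘(ℝ, ℝ) ∞ θ V ∧
      IsOrthonormalFrameOn (rotFrame e θ) V ∧ ∀ x ∈ V, (modes nabla (rotFrame e θ)).d2 x = 0 := by
  have hm := h.modes_smoothOn he hU
  obtain ⟨V, φ, hV, hpV, hVU, hφ, H⟩ := exists_smooth_angle hU hm.d1 hm.d2 hp hD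
  -- Half the angle of (Δ₁, Δ₂), to compensate for the double angle in the transformation law.
  have hθ : ContMDiffOn (𝓡 3) 𝓘(ℝ, ℝ) ∞ (fun x => φ x / 2) V := by
    simp only [div_eq_mul_inv]
    exact hφ.mul contMDiffOn_const
  refine ⟨V, fun x => φ x / 2, hV, hpV, hVU, hθ, (he.mono hVU).rotFrame hθ, fun x hx => ?_⟩
  rw [h.modes_rotFrame_d2 (he.mono hVU) hV hx hθ, mul_div_cancel₀ _ two_ne_zero]
  exact H x hx

/-- Near a point with non-vanishing bend, some rotation of the frame about the director aligns
its second vector with the bend. -/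
theorem IsLeviCivita.exists_rotFrame_bx_eq_zero (h : IsLeviCivita nabla)
    (he : IsOrthonormalFrameOn e U) (hU : IsOpen U) {p : M} (hp : p ∈ U)
    (hb : (modes nabla e).bsq p ≠ 0) :
    ∃ (V : Set M) (θ : M → ℝ), IsOpen V ∧ p ∈ V ∧ V ⊆ U ∧ ContMDiffOn (𝓡 3) 𝓘(ℝ, ℝ) ∞ θ V ∧
      IsOrthonormalFrameOn (rotFrame e θ) V ∧ ∀ x ∈ V, (modes nabla (rotFrame e θ)).bx x = 0 := by
  have hm := h.modes_smoothOn he hU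
  obtain ⟨V, θ, hV, hpV, hVU, hθ, H⟩ := exists_smooth_angle hU hm.bp hm.bx hp hb
  exact ⟨V, θ, hV, hpV, hVU, hθ, (he.mono hVU).rotFrame hθ, fun x hx =>
    modes_rotFrame_bx.trans (H x hx)⟩

/-- Near any point, some rotation of the frame about the director makes `n₂` and `n₃` parallel
along the director, up to multiples of the director. -/
theorem IsLeviCivita.exists_rotFrame_w1_eq_zero (h : IsLeviCivita nabla)
    (he : IsOrthonormalFrameOn e U) (hU : IsOpen U) {p : M} (hp : p ∈ U) :
    ∃ (V : Set M) (θ : M → ℝ), IsOpen V ∧ p ∈ V ∧ V ⊆ U ∧ ContMDiffOn (𝓡 3) 𝓘(ℝ, ℝ) ∞ θ V ∧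
      IsOrthonormalFrameOn (rotFrame e θ) V ∧ ∀ x ∈ V, (aux nabla (rotFrame e θ)).w1 x = 0 := by
  -- Solves n·∇θ = -ω₁; the director is a unit vector, so the characteristic direction does not
  -- vanish.
  obtain ⟨V, θ, hV, hpV, hVU, hθ, H⟩ := exists_local_solution_mvfderiv hU hp
    (fun x hx => he.smoothAt hU hx 0) (h.gam_smooth he hU 0 1 2).neg
    ((he.orthonormal p hp).ne_zero 0)
  refine ⟨V, θ, hV, hpV, hVU, hθ, (he.mono hVU).rotFrame hθ, fun x hx => ?_⟩
  rw [h.aux_rotFrame_w1 (he.mono hVU) hV hx hθ, aux_w1]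
  exact (congrArg _ (H x hx)).trans (add_neg_cancel _)

end Rotation

end DirectorField

end

/-! ### The theorem assembled from the preceding parts. -/

theorem mainTheorem1
    {M : Type*} [TopologicalSpace M] [ChartedSpace (EuclideanSpace ℝ (Fin 3)) M]
    [IsManifold (𝓡 3) ∞ M]
    [RiemannianBundle (fun x : M => TangentSpace (𝓡 3) x)]
    [IsContMDiffRiemannianBundle (𝓡 3) ∞ (EuclideanSpace ℝ (Fin 3))
      (fun x : M => TangentSpace (𝓡 3) x)]
    (nabla : CovariantDerivative (𝓡 3) (EuclideanSpace ℝ (Fin 3))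
      (fun x : M => TangentSpace (𝓡 3) x))
    (hnabla : DirectorField.IsLeviCivita nabla)
    (U : Set M) (hU : IsOpen U)
    (e : Fin 3 → DirectorField.VField M) (he : DirectorField.IsOrthonormalFrameOn e U) :
    -- the connection forms in terms of the modes and the auxiliary fields
    (∀ x ∈ U, ∀ v : TangentSpace (𝓡 3) x,
      DirectorField.connForm nabla e 0 1 x v =
        -(DirectorField.modes nabla e).bp x * DirectorField.coframe e 0 x v
        + ((DirectorField.modes nabla e).s x / 2 + (DirectorField.modes nabla e).d1 x)
            * DirectorField.coframe e 1 x v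
        + (-((DirectorField.modes nabla e).t x / 2) + (DirectorField.modes nabla e).d2 x)
            * DirectorField.coframe e 2 x v ∧
      DirectorField.connForm nabla e 0 2 x v =
        -(DirectorField.modes nabla e).bx x * DirectorField.coframe e 0 x v
        + ((DirectorField.modes nabla e).t x / 2 + (DirectorField.modes nabla e).d2 x)
            * DirectorField.coframe e 1 x v
        + ((DirectorField.modes nabla e).s x / 2 - (DirectorField.modes nabla e).d1 x)
            * DirectorField.coframe e 2 x v ∧
      DirectorField.connForm nabla e 1 2 x v =
        (DirectorField.aux nabla e).w1 x * DirectorField.coframe e 0 x v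
        + (DirectorField.aux nabla e).k21 x * DirectorField.coframe e 1 x v
        - (DirectorField.aux nabla e).k32 x * DirectorField.coframe e 2 x v) ∧
    -- the structure equations, evaluated on the frame
    (∀ x ∈ U, ∀ i k l : Fin 3,
      DirectorField.extD (DirectorField.coframe e i) (e k) (e l) x =
        ∑ p, DirectorField.wedge (DirectorField.coframe e p) (DirectorField.connForm nabla e p i)
          (e k) (e l) x) ∧
    (∀ x ∈ U, ∀ i j k l : Fin 3,
      DirectorField.extD (DirectorField.connForm nabla e i j) (e k) (e l) x
        - ∑ p, DirectorField.wedge (DirectorField.connForm nabla e i p)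
            (DirectorField.connForm nabla e p j) (e k) (e l) x =
        -DirectorField.riem nabla e i j k l x) ∧
    -- the symmetries of the curvature components, including the first Bianchi identity
    (∀ x ∈ U, ∀ i j k l : Fin 3,
      DirectorField.riem nabla e i j k l x = -DirectorField.riem nabla e j i k l x ∧
      DirectorField.riem nabla e i j k l x = -DirectorField.riem nabla e i j l k x ∧
      DirectorField.riem nabla e i j k l x = DirectorField.riem nabla e k l i j x) ∧
    -- the nine relations
    (∀ x ∈ U, DirectorField.NineRelations e (DirectorField.riem nabla e)
      (DirectorField.modes nabla e) (DirectorField.aux nabla e) x) ∧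
    -- gauge freedom: near each point, one of `Δ₂ = 0`, `b_× = 0`, `ω₁ = 0` can be achieved
    -- by rotating the frame about the director
    (∀ p ∈ U, (DirectorField.modes nabla e).Dsq p ≠ 0 →
      ∃ (V : Set M) (θ : M → ℝ), IsOpen V ∧ p ∈ V ∧ V ⊆ U ∧
        ContMDiffOn (𝓡 3) 𝓘(ℝ, ℝ) ∞ θ V ∧
        DirectorField.IsOrthonormalFrameOn (DirectorField.rotFrame e θ) V ∧
        ∀ x ∈ V, (DirectorField.modes nabla (DirectorField.rotFrame e θ)).d2 x = 0) ∧
    (∀ p ∈ U, (DirectorField.modes nabla e).bsq p ≠ 0 →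
      ∃ (V : Set M) (θ : M → ℝ), IsOpen V ∧ p ∈ V ∧ V ⊆ U ∧
        ContMDiffOn (𝓡 3) 𝓘(ℝ, ℝ) ∞ θ V ∧
        DirectorField.IsOrthonormalFrameOn (DirectorField.rotFrame e θ) V ∧
        ∀ x ∈ V, (DirectorField.modes nabla (DirectorField.rotFrame e θ)).bx x = 0) ∧
    (∀ p ∈ U,
      ∃ (V : Set M) (θ : M → ℝ), IsOpen V ∧ p ∈ V ∧ V ⊆ U ∧
        ContMDiffOn (𝓡 3) 𝓘(ℝ, ℝ) ∞ θ V ∧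
        DirectorField.IsOrthonormalFrameOn (DirectorField.rotFrame e θ) V ∧
        ∀ x ∈ V, (DirectorField.aux nabla (DirectorField.rotFrame e θ)).w1 x = 0) ∧
    -- `Δ ≠ 0`: the auxiliary fields are solved for, and the modes satisfy the three relations of
    -- first order and the three relations of second order
    ((∀ x ∈ U, (DirectorField.modes nabla e).Dsq x ≠ 0) → ∀ x ∈ U,
      (DirectorField.aux nabla e).k21 x = DirectorField.solvedK21 e
        (DirectorField.riem nabla e) (DirectorField.modes nabla e) x ∧
      (DirectorField.aux nabla e).k32 x = DirectorField.solvedK32 e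
        (DirectorField.riem nabla e) (DirectorField.modes nabla e) x ∧
      (DirectorField.aux nabla e).w1 x = DirectorField.solvedW1 e
        (DirectorField.riem nabla e) (DirectorField.modes nabla e) x ∧
      DirectorField.FirstOrderRelations e (DirectorField.riem nabla e)
        (DirectorField.modes nabla e) x ∧
      DirectorField.SecondOrderRelations e (DirectorField.riem nabla e)
        (DirectorField.modes nabla e) x) ∧
    -- `Δ ≠ 0`: for arbitrary fields, nothing of the nine relations is lost
    (∀ (R : Fin 3 → Fin 3 → Fin 3 → Fin 3 → M → ℝ) (m : DirectorField.Modes M)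
      (a : DirectorField.Aux M), m.SmoothOn U → (∀ x ∈ U, R 0 1 0 2 x = R 0 2 0 1 x) →
      (∀ x ∈ U, m.Dsq x ≠ 0) →
      ((∀ x ∈ U, DirectorField.NineRelations e R m a x) ↔
        ∀ x ∈ U,
          a.k21 x = DirectorField.solvedK21 e R m x ∧
          a.k32 x = DirectorField.solvedK32 e R m x ∧
          a.w1 x = DirectorField.solvedW1 e R m x ∧
          DirectorField.FirstOrderRelations e R m x ∧
          DirectorField.SecondOrderRelations e R m x)) ∧
    -- `Δ = 0`, `b ≠ 0`: `κ₂¹, κ₃²` are solved for, and `ω₁` as well where `t ≠ 0`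
    ((∀ x ∈ U, (DirectorField.modes nabla e).Dsq x = 0) →
      (∀ x ∈ U, (DirectorField.modes nabla e).bsq x ≠ 0) →
      (∀ x ∈ U,
        (DirectorField.aux nabla e).k21 x = DirectorField.solvedK21₀ e
          (DirectorField.riem nabla e) (DirectorField.modes nabla e) x ∧
        (DirectorField.aux nabla e).k32 x = DirectorField.solvedK32₀ e
          (DirectorField.riem nabla e) (DirectorField.modes nabla e) x ∧
        DirectorField.FirstOrderRelations₀ e (DirectorField.riem nabla e)
          (DirectorField.modes nabla e) x ∧
        DirectorField.LastTwoRelations₀ e (DirectorField.riem nabla e)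
          (DirectorField.modes nabla e) (DirectorField.aux nabla e).w1 x ∧
        DirectorField.RelationR2323₀ e (DirectorField.riem nabla e)
          (DirectorField.modes nabla e) (DirectorField.aux nabla e).w1 x) ∧
      ((∀ x ∈ U, (DirectorField.modes nabla e).t x ≠ 0) → ∀ x ∈ U,
        (DirectorField.aux nabla e).w1 x = DirectorField.solvedW1₀ e
          (DirectorField.riem nabla e) (DirectorField.modes nabla e) x ∧
        DirectorField.LastTwoRelations₀ e (DirectorField.riem nabla e)
          (DirectorField.modes nabla e)
          (DirectorField.solvedW1₀ e (DirectorField.riem nabla e)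
            (DirectorField.modes nabla e)) x)) ∧
    -- `Δ = 0`, `b ≠ 0`: for arbitrary fields, nothing of the nine relations is lost
    (∀ (R : Fin 3 → Fin 3 → Fin 3 → Fin 3 → M → ℝ) (m : DirectorField.Modes M)
      (a : DirectorField.Aux M), m.SmoothOn U →
      (∀ x ∈ U, m.Dsq x = 0) → (∀ x ∈ U, m.bsq x ≠ 0) →
      ((∀ x ∈ U, DirectorField.NineRelations e R m a x) ↔
        ∀ x ∈ U,
          a.k21 x = DirectorField.solvedK21₀ e R m x ∧
          a.k32 x = DirectorField.solvedK32₀ e R m x ∧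
          DirectorField.FirstOrderRelations₀ e R m x ∧
          DirectorField.LastTwoRelations₀ e R m a.w1 x ∧
          DirectorField.RelationR2323₀ e R m a.w1 x) ∧
      ((∀ x ∈ U, m.t x ≠ 0) →
        ((∀ x ∈ U, DirectorField.NineRelations e R m a x) ↔
          ∀ x ∈ U,
            a.k21 x = DirectorField.solvedK21₀ e R m x ∧
            a.k32 x = DirectorField.solvedK32₀ e R m x ∧
            a.w1 x = DirectorField.solvedW1₀ e R m x ∧
            DirectorField.FirstOrderRelations₀ e R m x ∧
            DirectorField.LastTwoRelations₀ e R m (DirectorField.solvedW1₀ e R m) x))) ∧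
    -- `Δ = 0`, `b = 0`: restrictions on the ambient curvature
    ((∀ x ∈ U, (DirectorField.modes nabla e).Dsq x = 0) →
      (∀ x ∈ U, (DirectorField.modes nabla e).bsq x = 0) → ∀ x ∈ U,
      DirectorField.riem nabla e 0 1 0 1 x = DirectorField.riem nabla e 0 2 0 2 x ∧
      DirectorField.riem nabla e 0 1 0 2 x = 0 ∧
      DirectorField.riem nabla e 0 2 0 1 x = 0) := by
  have nine := fun x hx => hnabla.nineRelations he hU (x := x) hx
  have hm := fun x hx => (hnabla.modes_smoothOn he hU).mDiffAt hU (x := x) hx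
  -- For the actual curvature, R_{1213} = R_{1312} is an instance of the pair symmetry.
  have hR := fun x hx => hnabla.riem_pair_symm he hU (x := x) hx 0 1 0 2
  refine ⟨fun x hx v => hnabla.connForm_eq he hU hx v,
    fun x hx i k l => hnabla.extD_coframe he hU hx i k l,
    fun x hx i j k l => ?_,
    fun x hx i j k l => ⟨hnabla.riem_antisymm_left he hU hx i j k l,
      DirectorField.riem_antisymm_right i j k l, hnabla.riem_pair_symm he hU hx i j k l⟩,
    nine,
    fun p hp hD => hnabla.exists_rotFrame_d2_eq_zero he hU hp hD,
    fun p hp hb => hnabla.exists_rotFrame_bx_eq_zero he hU hp hb,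
    fun p hp => hnabla.exists_rotFrame_w1_eq_zero he hU hp,
    fun hD => (DirectorField.forall_nineRelations_iff hU hm hR hD).1 nine,
    fun R m a h hR hD =>
      DirectorField.forall_nineRelations_iff hU (fun x hx => h.mDiffAt hU hx) hR hD,
    fun hD hb => ⟨(DirectorField.forall_nineRelations_iff₀ hU hm hD hb).1 nine,
      fun ht x hx => ?_⟩,
    fun R m a h hD hb => ⟨
      DirectorField.forall_nineRelations_iff₀ hU (fun x hx => h.mDiffAt hU hx) hD hb,
      fun ht => DirectorField.forall_nineRelations_iff₀_of_twist_ne_zero hU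
        (fun x hx => h.mDiffAt hU hx) hD hb ht⟩,
    fun hD hb x hx =>
      DirectorField.riem_eq_of_Dsq_eq_zero_of_bsq_eq_zero hU hm hD hb nine hR hx⟩
  · rw [hnabla.extD_connForm he hU hx, hnabla.riem_antisymm_left he hU hx]
  · obtain ⟨-, -, hw, -, hl⟩ :=
      (DirectorField.forall_nineRelations_iff₀_of_twist_ne_zero hU hm hD hb ht).1 nine x hx
    exact ⟨hw, hl⟩
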